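/- Let $\mathcal X,\mathcal Y,\mathcal S$ be finite alphabets. A finite-state channel (FSC) is given by a transition law $P_{Y,S^+|X,S}$ and an initial-state distribution $P(s_0)$. It is used with feedback and with the state known causally at the encoder: the message $M$ is uniform on $\{1,\dots,\lceil 2^{nR}\rceil\}$ and independent of $S_0$, the input at time $i$ is $x_i=f_i(m,s_0^{i-1},y^{i-1})$, given the past the pair $(y_i,s_i)$ is drawn from $P_{Y,S^+|X,S}(\cdot,\cdot|x_i,s_{i-1})$, and the decoder estimates $m$ from $y^n$. A rate $R$ is achievable if there is a sequence of such codes, one for each block length $n$, whose average probability of error tends to $0$ as $n\to\infty$; the feedback capacity $C_{\text{fb-csi}}$ is the supremum of the achievable rates. Suppose that the FSC is strongly connected: for all $s',s\in\mathcal S$ there are $T$ and input distributions $\{P(x_i|s_{i-1})\}_{i=1}^{T}$ such that $\sum_{i=1}^{T}P(S_i=s|S_0=s')>0$. Let $\mathcal U$ be a finite set and $f:\mathcal U\times\mathcal S\to\mathcal X$ a function such that $u\mapsto f(u,\cdot)$ is a bijection from $\mathcal U$ onto the set of all functions $\mathcal S\to\mathcal X$; thus $|\mathcal U|=|\mathcal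 X|^{|\mathcal S|}$. Then $$C_{\text{fb-csi}}=\lim_{N\to\infty}\frac1N\max_{P(u^N\|y^{N-1})}I(U^N\to Y^N).$$ In particular, the maxima are attained and the limit exists. Here $P(u^N\|y^{N-1})=\prod_{i=1}^N P(u_i|u^{i-1},y^{i-1})$ ranges over all causally conditional distributions, $I(U^N\to Y^N)=\sum_{i=1}^N I(U^i;Y_i|Y^{i-1})$ is the directed information in bits, and the joint distribution is $$P(x^N,s_0^N,y^N,u^N)=P(s_0)\,P(u^N\|y^{N-1})\prod_{i=1}^N\mathbb 1\{x_i=f(u_i,s_{i-1})\}\,P_{Y,S^+|X,S}(y_i,s_i|x_i,s_{i-1}).$$ -/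

import Mathlib

open Filter Topology

/-- A finite-state channel `P(y, s⁺ | x, s)` with input alphabet `X`, output alphabet `Y`, state
alphabet `S`, together with the distribution `P(s₀)` of its initial state. -/
structure FSC (X Y S : Type*) [Fintype X] [Fintype Y] [Fintype S] where
  /-- `kernel x s (y, s')` is the probability of output `y` and new state `s'`, given input `x`
  and current state `s`. -/
  kernel : X → S → Y × S → ℝ
  kernel_mem : ∀ x s, kernel x s ∈ stdSimplex ℝ (Y × S)
  /-- The distribution of the initial state. -/
  init : S → ℝ
  init_mem : init ∈ stdSimplex ℝ S

namespace FSC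

section Connectivity

variable {X Y S : Type*} [Fintype X] [Fintype Y] [Fintype S]

open Classical in
/-- `W.stateLaw p s' i s` is `P(S_i = s | S_0 = s')` when, for each `i`, the input at time `i + 1`
is drawn from `p i S_i`, that is, from a distribution of the form `P(x_{i+1} | s_i)`. -/
noncomputable def stateLaw (W : FSC X Y S) (p : ℕ → S → X → ℝ) (s' : S) : ℕ → S → ℝ
  | 0, s => if s = s' then 1 else 0
  | i + 1, s => ∑ r, ∑ x, ∑ y, W.stateLaw p s' i r * p i r x * W.kernel x r (y, s)

/-- The channel is strongly connected: every state can be reached with positive probability from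
every state in finitely many steps, using inputs of the form `P(x_i | s_{i-1})`. -/
def StronglyConnected (W : FSC X Y S) : Prop :=
  ∀ s' s : S, ∃ (T : ℕ) (p : ℕ → S → X → ℝ), (∀ i r, p i r ∈ stdSimplex ℝ X) ∧
    0 < ∑ i ∈ Finset.Icc 1 T, W.stateLaw p s' i s

end Connectivity

/-- A code of block length `n` with `M` messages. Positions are numbered `0, …, n - 1`: the input at
position `i` is a function of the message, the states `s_0, …, s_i` and the previous `i` outputs. -/
structure Code (X Y S : Type*) (n M : ℕ) where
  enc : Fin M → (i : Fin n) → (Fin (i + 1) → S) → (Fin i → Y) → X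
  dec : (Fin n → Y) → Fin M

section Capacity

variable {X Y S : Type*} [Fintype X] [Fintype Y] [Fintype S]

/-- The joint probability of the (uniformly distributed) message `m`, the states `s_0, …, s_n` and
the outputs `y_1, …, y_n`, when a given code is used on the channel. -/
noncomputable def codeLaw (W : FSC X Y S) {n M : ℕ} (c : Code X Y S n M)
    (m : Fin M) (s : Fin (n + 1) → S) (y : Fin n → Y) : ℝ :=
  (1 / (M : ℝ)) * W.init (s 0) *
    ∏ i : Fin n,
      W.kernel (c.enc m i (Fin.take (i + 1) (Nat.succ_le_succ i.2.le) s) (Fin.take i i.2.le y))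
        (s i.castSucc) (y i, s i.succ)

/-- The average probability that the decoded message differs from the message sent. -/
noncomputable def errorProb (W : FSC X Y S) {n M : ℕ} (c : Code X Y S n M) : ℝ :=
  ∑ m : Fin M, ∑ s : Fin (n + 1) → S, ∑ y : Fin n → Y,
    if c.dec y = m then 0 else W.codeLaw c m s y

/-- A rate `R` is achievable if there are codes of every length `n`, with `⌈2 ^ (n R)⌉` messages,
whose average probability of error tends to zero. -/
def Achievable (W : FSC X Y S) (R : ℝ) : Prop :=
  ∃ c : (n : ℕ) → Code X Y S n ⌈(2 : ℝ) ^ ((n : ℝ) * R)⌉₊,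
    Tendsto (fun n => W.errorProb (c n)) atTop (𝓝 0)

/-- The feedback capacity with state information known causally at the encoder. -/
noncomputable def capacity (W : FSC X Y S) : ℝ :=
  sSup {R : ℝ | W.Achievable R}

end Capacity

end FSC

section Information

variable {Ω A B C : Type*} [Fintype Ω]

open Classical in
/-- `P(F = a)` for a random variable `F` on a finite space with probability mass function `p`. -/
noncomputable def probEq (p : Ω → ℝ) (F : Ω → A) (a : A) : ℝ :=
  ∑ ω, if F ω = a then p ω else 0

/-- The conditional mutual information `I(F; G | H)` in bits, that is,
`∑ P(a, b, c) log₂ (P(a, b, c) P(c) / (P(a, c) P(b, c)))`. -/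
noncomputable def condMutualInfo (p : Ω → ℝ) (F : Ω → A) (G : Ω → B) (H : Ω → C) : ℝ :=
  ∑ ω, p ω * Real.logb 2
    (probEq p (fun ω' => (F ω', G ω', H ω')) (F ω, G ω, H ω) * probEq p H (H ω) /
      (probEq p (fun ω' => (F ω', H ω')) (F ω, H ω) *
        probEq p (fun ω' => (G ω', H ω')) (G ω, H ω)))

/-- The directed information `I(U^N → Y^N) = ∑ i, I(U^i; Y_i | Y^{i-1})`. -/
noncomputable def directedInfo {U Y : Type*} {N : ℕ} (p : Ω → ℝ)
    (u : Ω → Fin N → U) (y : Ω → Fin N → Y) : ℝ :=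
  ∑ i : Fin N, condMutualInfo p (fun ω => Fin.take (i + 1) i.2 (u ω)) (fun ω => y ω i)
    (fun ω => Fin.take i i.2.le (y ω))

end Information

/-- A causally conditional distribution `P(u^N || y^{N-1}) = ∏ i, P(u_i | u^{i-1}, y^{i-1})`,
given through its factors. -/
structure CausalDist (U Y : Type*) [Fintype U] (N : ℕ) where
  cond : (i : Fin N) → (Fin i → U) → (Fin i → Y) → U → ℝ
  cond_mem : ∀ i u y, cond i u y ∈ stdSimplex ℝ U

namespace FSC

variable {X Y S U : Type*} [Fintype X] [Fintype Y] [Fintype S] [Fintype U]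

/-- The joint law `P(s_0) P(u^N || y^{N-1}) ∏ i, P(y_i, s_i | f(u_i, s_{i-1}), s_{i-1})` of the
states, the outputs and the auxiliary variables; the inputs are `x_i = f(u_i, s_{i-1})`. -/
noncomputable def auxLaw (W : FSC X Y S) (f : U → S → X) {N : ℕ} (q : CausalDist U Y N) :
    (Fin (N + 1) → S) × (Fin N → Y) × (Fin N → U) → ℝ :=
  fun ω => W.init (ω.1 0) *
    (∏ i : Fin N, q.cond i (Fin.take i i.2.le ω.2.2) (Fin.take i i.2.le ω.2.1) (ω.2.2 i)) *
    ∏ i : Fin N, W.kernel (f (ω.2.2 i) (ω.1 i.castSucc)) (ω.1 i.castSucc) (ω.2.1 i, ω.1 i.succ)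

/-- The directed information `I(U^N → Y^N)` induced by `P(u^N || y^{N-1})`. -/
noncomputable def auxDirectedInfo (W : FSC X Y S) (f : U → S → X) {N : ℕ}
    (q : CausalDist U Y N) : ℝ :=
  directedInfo (W.auxLaw f q) (fun ω => ω.2.2) (fun ω => ω.2.1)

/-- The maximum of `I(U^N → Y^N)` over all `P(u^N || y^{N-1})`. -/
noncomputable def maxDirectedInfo (W : FSC X Y S) (f : U → S → X) (N : ℕ) : ℝ :=
  sSup (Set.range fun q : CausalDist U Y N => W.auxDirectedInfo f q)

end FSC

/-!
The idea is to describe the encoder by *code trees*. A code tree `t : List Y → U` prescribes, after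
the outputs `l`, the strategy `f (t l) : S → X`; running it on the channel gives a law `treeLaw` on
output sequences, so blocks of length `N` form an ordinary channel from code trees to `Y ^ N`.
A causally conditional distribution is the same thing as a random code tree
(`CausalDist.exists_isTreeMixture`, `CausalDist.exists_isTreeMixture_of_trees`), and the directed
information `I(U^N → Y^N)` telescopes to the mutual information between this random tree and the
outputs (`FSC.auxDirectedInfo_eq`, `FSC.auxDirectedInfo_eq_of_isTreeMixture`). It is continuous in
the causally conditional distribution, which ranges over a compact set, so the maxima are attained.

*Converse.* For a fixed decoder and a fixed message, the best encoder solves a finite Markov decision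
problem whose state consists of the channel state and the past outputs. Dynamic programming
(`FSC.minCost`) provides an optimal encoder that forgets all channel states but the current one, that
is, a code tree (`FSC.exists_trees_errorProb_le`). A code is thus no better than a uniform mixture
of code trees, and Fano's inequality, in the guise of Gibbs' inequality, bounds its size
(`FSC.log_card_le_maxDirectedInfo`).

*Achievability.* Convexity of mutual information in the channel gives an initial state `r` from which
a random code tree has at least the information `I(U^N → Y^N)` (`FSC.exists_state_le_info`). Time is
cut into slots of length `N + K`. In each slot the encoder steers the channel into the state `r`,
which by strong connectivity succeeds within `K` steps with probability close to one
(`FSC.tendsto_hitProb`), and then follows the code tree of the slot. The decoder does not see when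
the code tree starts. It uses the score of a slot obtained by adding up the likelihood ratios over
all `K + 1` possible starting times, which costs only a factor `K + 2` in the union bound, negligible
for large `N`. The probability that the score of the true codeword is too small is controlled by a
Chernoff bound. Its exponential moment is multiplicative over slots and can be bounded by the dynamic
programming value, which spares any description of the encoder of a long block: the encoder
that is optimal for the exponential moment is used (`FSC.exists_code_of_score`). Both bounds together
say that every rate that is exceeded by `I(U^N → Y^N) / N`, by a fixed margin and for arbitrarily
large `N`, is achievable (`FSC.achievable_of_frequently`). With the converse, this yields the limit.
-/

/-! ### Finite probability spaces -/

/-- **Gibbs' inequality** in variational form. -/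
theorem sum_mul_logb_le {ι : Type*} [Fintype ι] (p r g : ι → ℝ) (hp : ∀ i, 0 ≤ p i)
    (hr : ∀ i, 0 ≤ r i) (hg : ∀ i, 0 ≤ g i) (hpr : ∀ i, p i ≠ 0 → r i ≠ 0 ∧ g i ≠ 0)
    (hsum : ∑ i, r i * g i ≤ ∑ i, p i) :
    ∑ i, p i * Real.logb 2 (g i) ≤ ∑ i, p i * Real.logb 2 (p i / r i) := by
  have key : ∀ i, p i * Real.log (g i) - p i * Real.log (p i / r i) ≤ r i * g i - p i := by
    intro i
    rcases (hp i).eq_or_lt' with h | h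
    · simp only [h, zero_mul, sub_zero]
      exact mul_nonneg (hr i) (hg i)
    · obtain ⟨h1, h2⟩ := hpr i h.ne'
      have hri : 0 < r i := lt_of_le_of_ne (hr i) h1.symm
      have hgi : 0 < g i := lt_of_le_of_ne (hg i) h2.symm
      have h3 := Real.log_le_sub_one_of_pos (show 0 < g i / (p i / r i) by positivity)
      rw [Real.log_div h2 (by positivity)] at h3
      have h4 := mul_le_mul_of_nonneg_left h3 h.le
      have h5 : p i * (g i / (p i / r i) - 1) = r i * g i - p i := by field_simp
      linarith
  have h := Finset.sum_le_sum fun i (_ : i ∈ Finset.univ) => key i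
  rw [Finset.sum_sub_distrib, Finset.sum_sub_distrib] at h
  have h2 : (0 : ℝ) < Real.log 2 := Real.log_pos (by norm_num)
  simp only [Real.logb, mul_div_assoc', ← Finset.sum_div]
  exact div_le_div_of_nonneg_right (by linarith) h2.le

/-- Under a product distribution, the coordinate `z₀` has law `p z₀`. -/
theorem sum_pi_prod_mul_apply {Z : Type*} [Fintype Z] [DecidableEq Z] {A : Z → Type*}
    [∀ z, Fintype (A z)] (p : ∀ z, A z → ℝ) (hp : ∀ z, ∑ a, p z a = 1) (z₀ : Z) (h : A z₀ → ℝ) :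
    ∑ t : (∀ z, A z), (∏ z, p z (t z)) * h (t z₀) = ∑ a, p z₀ a * h a := by
  let φ : ∀ z, A z → ℝ := Function.update (fun _ _ => 1) z₀ h
  have h0 : φ z₀ = h := Function.update_self ..
  have h1 : ∀ z, z ≠ z₀ → ∀ a, φ z a = 1 := fun z hz a => by simp [φ, hz]
  calc _ = ∑ t : (∀ z, A z), ∏ z, (p z (t z) * φ z (t z)) := by
        refine Finset.sum_congr rfl fun t _ => ?_
        rw [Finset.prod_mul_distrib,
          Finset.prod_eq_single z₀ (f := fun z => φ z (t z)) (fun z _ hz => h1 z hz _) (by simp), h0]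
    _ = ∏ z, ∑ a, p z a * φ z a := by
        rw [Finset.prod_univ_sum, Fintype.piFinset_univ]
    _ = _ := by
        rw [Finset.prod_eq_single z₀ (fun z _ hz => by simp [h1 z hz, hp]) (by simp), h0]

/-- Under a product distribution, two different coordinates are independent. -/
theorem sum_pi_prod_mul_apply_mul_apply {Z A : Type*} [Fintype Z] [DecidableEq Z] [Fintype A]
    (p : A → ℝ) (hp : ∑ a, p a = 1) {z₀ z₁ : Z} (hz : z₀ ≠ z₁) (g h : A → ℝ) :
    ∑ t : Z → A, (∏ z, p (t z)) * (g (t z₀) * h (t z₁)) = (∑ a, p a * g a) * ∑ a, p a * h a := by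
  let φ : Z → A → ℝ := Function.update (Function.update (fun _ _ => 1) z₀ g) z₁ h
  have h0 : φ z₀ = g := by simp [φ, hz]
  have h1 : φ z₁ = h := by simp [φ]
  have h2 : ∀ z, z ≠ z₀ ∧ z ≠ z₁ → ∀ a, φ z a = 1 := fun z hz a => by simp [φ, hz.1, hz.2]
  calc _ = ∑ t : Z → A, ∏ z, (p (t z) * φ z (t z)) := by
        refine Finset.sum_congr rfl fun t _ => ?_
        rw [Finset.prod_mul_distrib, Finset.prod_eq_mul z₀ z₁ (f := fun z => φ z (t z)) hz
          (fun z _ hz => h2 z hz _) (by simp) (by simp), h0, h1]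
    _ = ∏ z, ∑ a, p a * φ z a := by
        rw [Finset.prod_univ_sum, Fintype.piFinset_univ]
    _ = _ := by
        rw [Finset.prod_eq_mul z₀ z₁ hz (fun z _ hz => by simp [h2 z hz, hp])
          (by simp) (by simp), h0, h1]

theorem pi_prod_mem_stdSimplex {Z : Type*} [Fintype Z] [DecidableEq Z] {A : Z → Type*} [∀ z, Fintype (A z)]
    (p : ∀ z, A z → ℝ) (hp : ∀ z, p z ∈ stdSimplex ℝ (A z)) :
    (fun t : ∀ z, A z => ∏ z, p z (t z)) ∈ stdSimplex ℝ (∀ z, A z) := by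
  refine ⟨fun t => Finset.prod_nonneg fun z _ => (hp z).1 _, ?_⟩
  have := Finset.prod_univ_sum (fun z => (Finset.univ : Finset (A z))) p
  rw [Fintype.piFinset_univ] at this
  rw [← this]
  exact Finset.prod_eq_one fun z _ => (hp z).2

open Classical in
/-- Random coding. If a test `D` rejects the true codeword with probability at most `δ`, and accepts
an independent codeword with probability at most `c` whatever the output, then some codebook with
`M` words has average error probability at most `δ + M c`. -/
theorem exists_codebook {C O : Type*} [Fintype C] [Fintype O] (P : C → ℝ)
    (hP : P ∈ stdSimplex ℝ C) (L : C → O → ℝ) (hL : ∀ a, L a ∈ stdSimplex ℝ O)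
    (D : C → O → Prop) (δ c : ℝ)
    (hmiss : ∑ a, P a * ∑ y, L a y * (if D a y then 0 else 1) ≤ δ)
    (hfalse : ∀ y, ∑ a, P a * (if D a y then 1 else 0) ≤ c) {M : ℕ} (hM : 0 < M) :
    ∃ (b : Fin M → C) (dec : O → Fin M),
      1 / (M : ℝ) * ∑ m, ∑ y, (if dec y = m then 0 else L (b m) y) ≤ δ + M * c := by
  -- Decode to a message whose codeword passes the test, if there is one.
  let dec : (Fin M → C) → O → Fin M := fun b y =>
    if h : ∃ m, D (b m) y then h.choose else ⟨0, hM⟩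
  have hdec : ∀ b y m, (if dec b y = m then 0 else L (b m) y) ≤
      L (b m) y * (if D (b m) y then 0 else 1) +
        ∑ m' ∈ Finset.univ.erase m, L (b m) y * (if D (b m') y then 1 else 0) := by
    intro b y m
    have hL0 : 0 ≤ L (b m) y := (hL (b m)).1 y
    have hs : ∀ m' ∈ Finset.univ.erase m, 0 ≤ L (b m) y * (if D (b m') y then (1 : ℝ) else 0) := by
      intro m' _; split_ifs <;> simp [hL0]
    split_ifs with h1 h2 h2
    · simpa using Finset.sum_nonneg hs
    · simpa using add_nonneg hL0 (Finset.sum_nonneg hs)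
    · have hex : ∃ m, D (b m) y := ⟨m, h2⟩
      have hd : dec b y = hex.choose := by simp only [dec, dif_pos hex]
      have hc := hex.choose_spec
      rw [← hd] at hc
      have := Finset.single_le_sum hs (Finset.mem_erase.2 ⟨h1, Finset.mem_univ (dec b y)⟩)
      rw [if_pos hc] at this
      simpa using this
    · simpa using Finset.sum_nonneg hs
  have hc0 : ∀ a, ∑ y, L a y = 1 := fun a => (hL a).2
  have key : ∑ b : Fin M → C, (∏ m, P (b m)) *
      (1 / (M : ℝ) * ∑ m, ∑ y, (if dec b y = m then 0 else L (b m) y)) ≤ δ + M * c := by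
    have hper : ∀ m, ∑ b : Fin M → C, (∏ m, P (b m)) *
        ∑ y, (if dec b y = m then 0 else L (b m) y) ≤ δ + M * c := by
      intro m
      calc _ ≤ ∑ b : Fin M → C, (∏ m, P (b m)) * ∑ y, (L (b m) y * (if D (b m) y then 0 else 1) +
              ∑ m' ∈ Finset.univ.erase m, L (b m) y * (if D (b m') y then 1 else 0)) := by
            refine Finset.sum_le_sum fun b _ => mul_le_mul_of_nonneg_left
              (Finset.sum_le_sum fun y _ => hdec b y m) (Finset.prod_nonneg fun _ _ => hP.1 _)
        _ = ∑ b : Fin M → C, (∏ m, P (b m)) * ∑ y, (L (b m) y * (if D (b m) y then 0 else 1)) +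
            ∑ m' ∈ Finset.univ.erase m, ∑ y, ∑ b : Fin M → C, (∏ m, P (b m)) *
              (L (b m) y * (if D (b m') y then 1 else 0)) := by
            simp only [Finset.sum_add_distrib, mul_add, Finset.mul_sum]
            congr 1
            rw [Finset.sum_comm, Finset.sum_comm (s := Finset.univ.erase m)]
            refine Finset.sum_congr rfl fun y _ => ?_
            rw [Finset.sum_comm]
        _ ≤ δ + ∑ m' ∈ Finset.univ.erase m, c := by
            refine add_le_add ?_ (Finset.sum_le_sum fun m' hm' => ?_)
            · rw [sum_pi_prod_mul_apply (fun _ => P) (fun _ => hP.2) m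
                (fun a => ∑ y, (L a y * (if D a y then 0 else 1)))]
              exact hmiss
            · have hne : m ≠ m' := (Finset.ne_of_mem_erase hm').symm
              simp_rw [fun y => sum_pi_prod_mul_apply_mul_apply P hP.2 hne (fun a => L a y)
                (fun a => if D a y then (1 : ℝ) else 0)]
              calc _ ≤ ∑ y, (∑ a, P a * L a y) * c := Finset.sum_le_sum fun y _ =>
                    mul_le_mul_of_nonneg_left (hfalse y)
                      (Finset.sum_nonneg fun a _ => mul_nonneg (hP.1 a) ((hL a).1 y))
                _ = c := by
                    rw [← Finset.sum_mul, Finset.sum_comm]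
                    simp [← Finset.mul_sum, hc0, hP.2]
        _ ≤ δ + M * c := by
            have hcn : 0 ≤ c := by
              obtain ⟨a⟩ : Nonempty C := by
                by_contra h
                have := hP.2
                rw [not_nonempty_iff] at h
                simp at this
              obtain ⟨y⟩ : Nonempty O := by
                by_contra h
                have := hc0 a
                rw [not_nonempty_iff] at h
                simp at this
              refine le_trans (Finset.sum_nonneg fun a _ => mul_nonneg (hP.1 a) ?_) (hfalse y)
              split_ifs <;> norm_num
            rw [Finset.sum_const, nsmul_eq_mul]
            have : ((Finset.univ.erase m).card : ℝ) ≤ M := by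
              exact_mod_cast (Finset.card_le_univ _).trans (by simp)
            gcongr
    have hM' : (0 : ℝ) < M := by exact_mod_cast hM
    calc _ = 1 / (M : ℝ) * ∑ m, ∑ b : Fin M → C, (∏ m, P (b m)) *
            ∑ y, (if dec b y = m then 0 else L (b m) y) := by
          rw [Finset.sum_comm, Finset.mul_sum]
          refine Finset.sum_congr rfl fun b _ => ?_
          rw [← Finset.mul_sum]; ring
      _ ≤ 1 / (M : ℝ) * ∑ m : Fin M, (δ + M * c) := by
          gcongr with m _; exact hper m
      _ = _ := by simp; field_simp
  by_contra! hcon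
  have hPi := pi_prod_mem_stdSimplex (fun _ : Fin M => P) (fun _ => hP)
  have : δ + M * c < δ + M * c := by
    calc δ + M * c = ∑ b : Fin M → C, (∏ m, P (b m)) * (δ + M * c) := by
          rw [← Finset.sum_mul, hPi.2, one_mul]
      _ < _ := by
          obtain ⟨b, hb⟩ : ∃ b : Fin M → C, 0 < ∏ m, P (b m) := by
            by_contra! h
            have := Finset.sum_nonpos fun b (_ : b ∈ Finset.univ) => h b
            linarith [hPi.2]
          exact Finset.sum_lt_sum (fun b _ => mul_le_mul_of_nonneg_left (hcon b (dec b)).le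
            (hPi.1 b)) ⟨b, Finset.mem_univ _, mul_lt_mul_of_pos_left (hcon b (dec b)) hb⟩
      _ ≤ _ := key
  exact lt_irrefl _ this

theorem HasDerivAt.eventually_lt_of_neg {F : ℝ → ℝ} {F' x : ℝ} (h : HasDerivAt F F' x)
    (hF : F' < 0) : ∀ᶠ y in 𝓝[>] x, F y < F x := by
  have h1 : Tendsto (slope F x) (𝓝[>] x) (𝓝 F') :=
    h.tendsto_slope.mono_left (nhdsWithin_mono _ fun y (hy : x < y) => hy.ne')
  filter_upwards [h1.eventually_lt_const hF, self_mem_nhdsWithin] with y hy (hxy : x < y)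
  rw [slope_def_field, div_neg_iff] at hy
  rcases hy with hy | hy <;> linarith [hy.1, hy.2]

/-- The exponent in Chernoff's bound is positive below the mean: at `l = 0` the left side of the last
inequality is `1`, and its derivative is `log 2 * (θ - h * E[log₂ x])`. -/
theorem exists_pos_mul_sum_rpow_lt_one {ι : Type*} [Fintype ι] (m x : ι → ℝ)
    (hm : m ∈ stdSimplex ℝ ι) (hx : ∀ i, 0 < x i) {θ h : ℝ} (h0 : 0 < h) (hθ0 : 0 ≤ θ)
    (hθ : θ < h * ∑ i, m i * Real.logb 2 (x i)) :
    ∃ l : ℝ, 0 < l ∧ ∑ i, m i * x i ^ (-l) ≤ 1 ∧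
      ((2 : ℝ) ^ θ) ^ l * (1 - h * (1 - ∑ i, m i * x i ^ (-l))) < 1 := by
  have hd : HasDerivAt (fun l : ℝ => ∑ i, m i * x i ^ (-l)) (-∑ i, m i * Real.log (x i)) 0 := by
    rw [← Finset.sum_neg_distrib]
    refine HasDerivAt.fun_sum fun i _ => ?_
    have := ((hasDerivAt_id (0 : ℝ)).fun_neg.const_rpow (hx i)).const_mul (m i)
    exact this.congr_deriv (by simp)
  have hF0 : ∑ i, m i * x i ^ (-(0 : ℝ)) = 1 := by simpa using hm.2
  have hd2 : HasDerivAt (fun l : ℝ => ((2 : ℝ) ^ θ) ^ l * (1 - h * (1 - ∑ i, m i * x i ^ (-l))))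
      (Real.log 2 * θ - h * ∑ i, m i * Real.log (x i)) 0 := by
    have h1 := (hasDerivAt_id (0 : ℝ)).const_rpow (show (0 : ℝ) < 2 ^ θ by positivity)
    have h2 := ((hd.const_sub 1).const_mul h).const_sub 1
    refine (h1.fun_mul h2).congr_deriv ?_
    simp only [id_eq, Real.rpow_zero, hF0, Real.log_rpow (show (0 : ℝ) < 2 by norm_num)]
    ring
  have hl2 : (0 : ℝ) < Real.log 2 := Real.log_pos (by norm_num)
  have hI : ∑ i, m i * Real.logb 2 (x i) = (∑ i, m i * Real.log (x i)) / Real.log 2 := by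
    simp only [Real.logb, mul_div_assoc', ← Finset.sum_div]
  rw [hI, mul_div_assoc', lt_div_iff₀ hl2] at hθ
  have hpos : 0 < ∑ i, m i * Real.log (x i) := by
    have : 0 < h * ∑ i, m i * Real.log (x i) := lt_of_le_of_lt (by positivity) hθ
    exact (pos_iff_pos_of_mul_pos this).1 h0
  obtain ⟨l, ⟨h1, h2⟩, h3⟩ := (((hd.eventually_lt_of_neg (by linarith)).and
    (hd2.eventually_lt_of_neg (by linarith))).and self_mem_nhdsWithin).exists
  rw [hF0] at h1 h2
  exact ⟨l, h3, h1.le, by simpa using h2⟩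

theorem sum_fin_cons {A : Type*} [Fintype A] {n : ℕ} (F : (Fin (n + 1) → A) → ℝ) :
    ∑ v, F v = ∑ a, ∑ v : Fin n → A, F (Fin.cons a v) := by
  rw [← Fintype.sum_prod_type', ← (Fin.consEquiv fun _ => A).sum_comp]
  rfl

theorem sum_fin_snoc {A : Type*} [Fintype A] {n : ℕ} (F : (Fin (n + 1) → A) → ℝ) :
    ∑ v, F v = ∑ v : Fin n → A, ∑ a, F (Fin.snoc v a) := by
  rw [Finset.sum_comm, ← Fintype.sum_prod_type', ← (Fin.snocEquiv fun _ => A).sum_comp]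
  rfl

/-! ### Code trees and the laws of the outputs -/

/-- The inputs prescribed by a code tree `t` along the output sequence `y`. -/
def treePath {U Y : Type*} (t : List Y → U) {n : ℕ} (y : Fin n → Y) : Fin n → U :=
  fun i => t (List.ofFn (Fin.take i i.2.le y))

namespace FSC

variable {X Y S U : Type*} [Fintype X] [Fintype Y] [Fintype S]

/-- The probability `P(y^n || u^n)` of the outputs when the channel starts in a given state and the
strategies `f (u 0), f (u 1), …` are used. -/
def outLaw (W : FSC X Y S) (f : U → S → X) : (n : ℕ) → S → (Fin n → U) → (Fin n → Y) → ℝ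
  | 0, _, _, _ => 1
  | n + 1, s, u, y => ∑ s', W.kernel (f (u 0) s) s (y 0, s') *
      W.outLaw f n s' (Fin.tail u) (Fin.tail y)

/-- The probability of a list of outputs when the channel starts in a given state and the encoder
follows a code tree. -/
def treeLaw (W : FSC X Y S) (f : U → S → X) : S → (List Y → U) → List Y → ℝ
  | _, _, [] => 1
  | s, t, y :: l => ∑ s', W.kernel (f (t []) s) s (y, s') *
      W.treeLaw f s' (fun l => t (y :: l)) l

/-- The least expected value of the cost `g` of the first `n` outputs, over all encoders that observe
the channel state, when the channel starts in a given state. It is defined by the recursion of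
dynamic programming. -/
noncomputable def minCost (W : FSC X Y S) : ℕ → S → (List Y → ℝ) → ℝ
  | 0, _, g => g []
  | n + 1, s, g => ⨅ x, ∑ y, ∑ s', W.kernel x s (y, s') * W.minCost n s' (fun l => g (y :: l))

variable (W : FSC X Y S) (f : U → S → X)

theorem kernel_nonneg (x : X) (s : S) (z : Y × S) : 0 ≤ W.kernel x s z := (W.kernel_mem x s).1 z

theorem sum_kernel (x : X) (s : S) : ∑ y, ∑ s', W.kernel x s (y, s') = 1 := by
  rw [← Fintype.sum_prod_type']
  exact (W.kernel_mem x s).2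

theorem kernel_avg_le {x : X} {s : S} {F G : Y → S → ℝ} (h : ∀ y s', F y s' ≤ G y s') :
    ∑ y, ∑ s', W.kernel x s (y, s') * F y s' ≤ ∑ y, ∑ s', W.kernel x s (y, s') * G y s' :=
  Finset.sum_le_sum fun _ _ => Finset.sum_le_sum fun _ _ =>
    mul_le_mul_of_nonneg_left (h _ _) (W.kernel_nonneg _ _ _)

theorem kernel_avg_const (x : X) (s : S) (c : ℝ) :
    ∑ y, ∑ s', W.kernel x s (y, s') * c = c := by
  simp only [← Finset.sum_mul]
  rw [W.sum_kernel, one_mul]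

theorem outLaw_nonneg (n : ℕ) (s : S) (u : Fin n → U) (y : Fin n → Y) : 0 ≤ W.outLaw f n s u y := by
  induction n generalizing s with
  | zero => exact zero_le_one
  | succ n ih => exact Finset.sum_nonneg fun s' _ => mul_nonneg (W.kernel_nonneg _ _ _) (ih ..)

theorem outLaw_le_one (n : ℕ) (s : S) (u : Fin n → U) (y : Fin n → Y) : W.outLaw f n s u y ≤ 1 := by
  induction n generalizing s with
  | zero => exact le_rfl
  | succ n ih =>
    calc W.outLaw f (n + 1) s u y ≤ ∑ s', W.kernel (f (u 0) s) s (y 0, s') := by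
          refine Finset.sum_le_sum fun s' _ => ?_
          exact mul_le_of_le_one_right (W.kernel_nonneg _ _ _) (ih ..)
      _ ≤ ∑ z, ∑ s', W.kernel (f (u 0) s) s (z, s') :=
          Finset.single_le_sum (f := fun z => ∑ s', W.kernel (f (u 0) s) s (z, s'))
            (fun z _ => Finset.sum_nonneg fun s' _ => W.kernel_nonneg _ _ _) (Finset.mem_univ _)
      _ = 1 := W.sum_kernel _ _

/-- The outputs do not depend on later inputs. -/
theorem sum_outLaw_snoc (n : ℕ) (s : S) (u : Fin (n + 1) → U) (y : Fin n → Y) :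
    ∑ z, W.outLaw f (n + 1) s u (Fin.snoc y z) = W.outLaw f n s (Fin.init u) y := by
  induction n generalizing s with
  | zero => simpa [outLaw, Fin.snoc] using W.sum_kernel (f (u 0) s) s
  | succ n ih =>
    have h0 : ∀ z, (Fin.snoc y z : Fin (n + 2) → Y) 0 = y 0 := fun z => by
      rw [← Fin.castSucc_zero, Fin.snoc_castSucc]
    have h1 : ∀ z, Fin.tail (Fin.snoc y z : Fin (n + 2) → Y) = Fin.snoc (Fin.tail y) z := by
      intro z
      conv_lhs => rw [← Fin.cons_self_tail y, ← Fin.cons_snoc_eq_snoc_cons, Fin.tail_cons]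
    calc _ = ∑ z, ∑ s', W.kernel (f (u 0) s) s (y 0, s') *
            W.outLaw f (n + 1) s' (Fin.tail u) (Fin.snoc (Fin.tail y) z) := by
          refine Finset.sum_congr rfl fun z _ => ?_
          rw [outLaw, h0, h1]
      _ = ∑ s', W.kernel (f (u 0) s) s (y 0, s') *
            W.outLaw f n s' (Fin.init (Fin.tail u)) (Fin.tail y) := by
          rw [Finset.sum_comm]
          simp_rw [← Finset.mul_sum, ih]
      _ = _ := rfl

theorem sum_prod_kernel_eq_outLaw (n : ℕ) (s₀ : S) (u : Fin n → U) (y : Fin n → Y) :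
    ∑ s : Fin n → S, ∏ i : Fin n,
      W.kernel (f (u i) ((Fin.cons s₀ s : Fin (n + 1) → S) i.castSucc))
        ((Fin.cons s₀ s : Fin (n + 1) → S) i.castSucc)
        (y i, (Fin.cons s₀ s : Fin (n + 1) → S) i.succ) = W.outLaw f n s₀ u y := by
  induction n generalizing s₀ with
  | zero => simp [outLaw]
  | succ n ih =>
    rw [sum_fin_cons, outLaw]
    refine Finset.sum_congr rfl fun s₁ _ => ?_
    rw [← ih, Finset.mul_sum]
    refine Finset.sum_congr rfl fun s _ => ?_
    rw [Fin.prod_univ_succ]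
    rfl

theorem sum_states_eq_outLaw (n : ℕ) (u : Fin n → U) (y : Fin n → Y) :
    ∑ s : Fin (n + 1) → S, W.init (s 0) * ∏ i : Fin n,
      W.kernel (f (u i) (s i.castSucc)) (s i.castSucc) (y i, s i.succ) =
    ∑ s₀, W.init s₀ * W.outLaw f n s₀ u y := by
  rw [sum_fin_cons]
  refine Finset.sum_congr rfl fun s₀ _ => ?_
  rw [← sum_prod_kernel_eq_outLaw, Finset.mul_sum]
  simp only [Fin.cons_zero]

theorem treeLaw_ofFn (n : ℕ) (s : S) (t : List Y → U) (y : Fin n → Y) :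
    W.treeLaw f s t (List.ofFn y) = W.outLaw f n s (treePath t y) y := by
  induction n generalizing s t with
  | zero => simp [treeLaw, outLaw]
  | succ n ih =>
    rw [List.ofFn_succ, treeLaw, outLaw]
    refine Finset.sum_congr rfl fun s' _ => ?_
    have := ih s' (fun l => t (y 0 :: l)) (Fin.tail y)
    rw [show (fun i : Fin n => y i.succ) = Fin.tail y from rfl, this]
    have h2 : Fin.tail (treePath t y) = treePath (fun l => t (y 0 :: l)) (Fin.tail y) := by
      funext i
      simp only [treePath, Fin.tail]
      congr 1
      exact List.ofFn_succ
    rw [h2]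
    rfl

theorem treeLaw_nonneg (s : S) (t : List Y → U) (l : List Y) : 0 ≤ W.treeLaw f s t l := by
  induction l generalizing s t with
  | nil => exact zero_le_one
  | cons y l ih => exact Finset.sum_nonneg fun s' _ => mul_nonneg (W.kernel_nonneg _ _ _) (ih ..)

theorem sum_treeLaw_succ_mul (n : ℕ) (s : S) (t : List Y → U) (g : List Y → ℝ) :
    ∑ y : Fin (n + 1) → Y, W.treeLaw f s t (List.ofFn y) * g (List.ofFn y) =
      ∑ z, ∑ s', W.kernel (f (t []) s) s (z, s') *
        ∑ y : Fin n → Y, W.treeLaw f s' (fun l => t (z :: l)) (List.ofFn y) *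
          g (z :: List.ofFn y) := by
  rw [sum_fin_cons]
  refine Finset.sum_congr rfl fun z _ => ?_
  simp only [List.ofFn_cons, treeLaw, Finset.sum_mul, Finset.mul_sum]
  rw [Finset.sum_comm]
  simp only [mul_assoc]

theorem sum_treeLaw (n : ℕ) (s : S) (t : List Y → U) :
    ∑ y : Fin n → Y, W.treeLaw f s t (List.ofFn y) = 1 := by
  induction n generalizing s t with
  | zero => simp [treeLaw]
  | succ n ih =>
    have := W.sum_treeLaw_succ_mul f n s t (fun _ => 1)
    simpa only [mul_one, ih, sum_kernel] using this

/-! ### Dynamic programming -/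

theorem minCost_succ_le (n : ℕ) (s : S) (g : List Y → ℝ) (x : X) : W.minCost (n + 1) s g ≤
    ∑ y, ∑ s', W.kernel x s (y, s') * W.minCost n s' (fun l => g (y :: l)) :=
  ciInf_le (Set.finite_range _).bddBelow x

theorem exists_minCost_succ_eq [Nonempty X] (n : ℕ) (s : S) (g : List Y → ℝ) :
    ∃ x, ∑ y, ∑ s', W.kernel x s (y, s') * W.minCost n s' (fun l => g (y :: l)) =
      W.minCost (n + 1) s g :=
  exists_eq_ciInf_of_finite

theorem minCost_mono [Nonempty X] (n : ℕ) (s : S) {g g' : List Y → ℝ} (h : ∀ l, g l ≤ g' l) :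
    W.minCost n s g ≤ W.minCost n s g' := by
  induction n generalizing s g g' with
  | zero => exact h []
  | succ n ih =>
    obtain ⟨x, hx⟩ := W.exists_minCost_succ_eq n s g'
    rw [← hx]
    exact (W.minCost_succ_le n s g x).trans (W.kernel_avg_le fun y s' => ih s' fun l => h _)

theorem minCost_mul_le [Nonempty X] (n : ℕ) (s : S) (c : ℝ) (g : List Y → ℝ) :
    W.minCost n s (fun l => c * g l) ≤ c * W.minCost n s g := by
  induction n generalizing s g with
  | zero => exact le_rfl
  | succ n ih =>
    obtain ⟨x, hx⟩ := W.exists_minCost_succ_eq n s g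
    rw [← hx]
    refine (W.minCost_succ_le n s _ x).trans ((W.kernel_avg_le fun y s' => ih s' _).trans_eq ?_)
    simp only [Finset.mul_sum]
    exact Finset.sum_congr rfl fun _ _ => Finset.sum_congr rfl fun _ _ => by ring

theorem minCost_le_of_le [Nonempty X] (n : ℕ) (s : S) {g : List Y → ℝ} {c : ℝ}
    (h : ∀ l, g l ≤ c) : W.minCost n s g ≤ c := by
  induction n generalizing s g with
  | zero => exact h []
  | succ n ih =>
    obtain ⟨x⟩ := ‹Nonempty X›
    exact (W.minCost_succ_le n s g x).trans
      ((W.kernel_avg_le fun y s' => ih s' fun l => h _).trans_eq (W.kernel_avg_const x s c))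

theorem minCost_nonneg [Nonempty X] (n : ℕ) (s : S) {g : List Y → ℝ}
    (h : ∀ l, 0 ≤ g l) : 0 ≤ W.minCost n s g := by
  induction n generalizing s g with
  | zero => exact h []
  | succ n ih =>
    exact le_ciInf fun x => Finset.sum_nonneg fun y _ => Finset.sum_nonneg fun s' _ =>
      mul_nonneg (W.kernel_nonneg _ _ _) (ih s' fun l => h _)

theorem minCost_le_treeLaw [Nonempty X] (n : ℕ) (s : S) (t : List Y → U) (g : List Y → ℝ) :
    W.minCost n s g ≤ ∑ y : Fin n → Y, W.treeLaw f s t (List.ofFn y) * g (List.ofFn y) := by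
  induction n generalizing s t g with
  | zero => simp [minCost, treeLaw]
  | succ n ih =>
    rw [sum_treeLaw_succ_mul]
    exact (W.minCost_succ_le n s g _).trans (W.kernel_avg_le fun y s' => ih s' _ _)

/-- The minimal cost is attained by an encoder that uses only the current channel state and the past
outputs, simultaneously for all initial states. -/
theorem exists_treeLaw_eq_minCost [Nonempty X] (hf : Function.Surjective f) (n : ℕ)
    (g : List Y → ℝ) : ∃ t : List Y → U, ∀ s,
      ∑ y : Fin n → Y, W.treeLaw f s t (List.ofFn y) * g (List.ofFn y) = W.minCost n s g := by
  induction n generalizing g with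
  | zero =>
    obtain ⟨u, -⟩ := hf fun _ => Classical.arbitrary X
    exact ⟨fun _ => u, fun s => by simp [minCost, treeLaw]⟩
  | succ n ih =>
    choose t ht using fun y : Y => ih fun l => g (y :: l)
    choose x hx using fun s => W.exists_minCost_succ_eq n s g
    obtain ⟨u, hu⟩ := hf x
    refine ⟨fun l => match l with
      | [] => u
      | y :: l => t y l, fun s => ?_⟩
    rw [sum_treeLaw_succ_mul, ← hx s]
    simp only [ht, hu]

/-- Memory of the past channel states does not help an encoder. -/
theorem minCost_le_of_encoder [Nonempty X] {n : ℕ}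
    (e : (i : Fin n) → (Fin (i + 1) → S) → (Fin i → Y) → X) (s₀ : S) (g : List Y → ℝ) :
    W.minCost n s₀ g ≤ ∑ s : Fin n → S, ∑ y : Fin n → Y, (∏ i : Fin n,
      W.kernel (e i (Fin.take (i + 1) (Nat.succ_le_succ i.2.le) (Fin.cons s₀ s : Fin (n + 1) → S))
          (Fin.take i i.2.le y))
        ((Fin.cons s₀ s : Fin (n + 1) → S) i.castSucc)
        (y i, (Fin.cons s₀ s : Fin (n + 1) → S) i.succ)) * g (List.ofFn y) := by
  induction n generalizing s₀ g with
  | zero => simp [minCost]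
  | succ n ih =>
    refine (W.minCost_succ_le n s₀ g (e 0 (fun _ => s₀) Fin.elim0)).trans ?_
    refine (W.kernel_avg_le fun y s₁ => ih (fun i s y' => e i.succ (Fin.cons s₀ s) (Fin.cons y y'))
      s₁ _).trans_eq ?_
    rw [sum_fin_cons, Finset.sum_comm]
    refine Finset.sum_congr rfl fun s₁ _ => ?_
    simp only [Finset.mul_sum]
    rw [Finset.sum_comm]
    refine Finset.sum_congr rfl fun s _ => ?_
    rw [sum_fin_cons]
    refine Finset.sum_congr rfl fun y _ => Finset.sum_congr rfl fun y' _ => ?_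
    rw [Fin.prod_univ_succ, List.ofFn_cons, mul_assoc]
    have h1 : ∀ i : Fin n, (Fin.cons s₀ (Fin.take (i + 1) (Nat.succ_le_succ i.2.le)
        (Fin.cons s₁ s : Fin (n + 1) → S)) : Fin (i + 1 + 1) → S) =
        Fin.take (i + 1 + 1) (Nat.succ_le_succ (Nat.succ_le_succ i.2.le))
          (Fin.cons s₀ (Fin.cons s₁ s : Fin (n + 1) → S) : Fin (n + 2) → S) := by
      intro i; funext j
      refine Fin.cases rfl (fun j => rfl) j
    have h2 : ∀ i : Fin n, (Fin.cons y (Fin.take i i.2.le y') : Fin (i + 1) → Y) =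
        Fin.take (i + 1) (Nat.succ_le_succ i.2.le) (Fin.cons y y' : Fin (n + 1) → Y) := by
      intro i; funext j
      refine Fin.cases rfl (fun j => rfl) j
    simp only [h1, h2]
    have h3 : (fun _ => s₀ : Fin (0 + 1) → S) = Fin.take (0 + 1) (by omega)
          (Fin.cons s₀ (Fin.cons s₁ s : Fin (n + 1) → S) : Fin (n + 2) → S) := by
      funext j
      rw [Fin.fin_one_eq_zero j]
      rfl
    have h4 : (Fin.elim0 : Fin 0 → Y) =
        Fin.take 0 (by omega) (Fin.cons y y' : Fin (n + 1) → Y) := Subsingleton.elim _ _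
    exact congrArg (fun x => W.kernel x s₀ (y, s₁) * _) (congrArg₂ (e 0) h3 h4)

end FSC

/-! ### The directed information as a single logarithm -/

theorem Fin.take_snoc_of_le {A : Type*} {N : ℕ} (a : Fin N → A) (b : A) (k : ℕ) (hk : k ≤ N) :
    Fin.take k (hk.trans N.le_succ) (Fin.snoc a b : Fin (N + 1) → A) = Fin.take k hk a := by
  funext j
  exact Fin.snoc_castSucc (α := fun _ => A) b a (Fin.castLE hk j)

theorem Fin.take_succ_eq_iff {A : Type*} {N : ℕ} (i : Fin N) (y y' : Fin N → A) :
    Fin.take (i + 1) i.2 y = Fin.take (i + 1) i.2 y' ↔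
      y i = y' i ∧ Fin.take i i.2.le y = Fin.take i i.2.le y' := by
  constructor
  · intro h
    refine ⟨congrFun h (Fin.last i), ?_⟩
    funext j
    exact congrFun h j.castSucc
  · rintro ⟨h1, h2⟩
    funext j
    refine Fin.lastCases h1 (fun j => congrFun h2 j) j

namespace CausalDist

variable {U Y : Type*} [Fintype U] {N : ℕ}

/-- The probability `P(u^N || y^{N-1})`. -/
noncomputable def weight (q : CausalDist U Y N) (u : Fin N → U) (y : Fin N → Y) : ℝ :=
  ∏ i : Fin N, q.cond i (Fin.take i i.2.le u) (Fin.take i i.2.le y) (u i)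

/-- The first `k` factors of a causally conditional distribution. -/
def restrict (q : CausalDist U Y N) (k : ℕ) (h : k ≤ N) : CausalDist U Y k where
  cond i := q.cond (Fin.castLE h i)
  cond_mem i := q.cond_mem (Fin.castLE h i)

theorem weight_nonneg (q : CausalDist U Y N) (u : Fin N → U) (y : Fin N → Y) : 0 ≤ q.weight u y :=
  Finset.prod_nonneg fun i _ => (q.cond_mem i _ _).1 _

theorem weight_snoc (q : CausalDist U Y (N + 1)) (u : Fin N → U) (v : U) (y : Fin N → Y) (z : Y) :
    q.weight (Fin.snoc u v) (Fin.snoc y z) =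
      (q.restrict N N.le_succ).weight u y * q.cond (Fin.last N) u y v := by
  rw [weight, Fin.prod_univ_castSucc]
  congr 1
  · refine Finset.prod_congr rfl fun i _ => ?_
    rw [Fin.snoc_castSucc]
    exact congrArg₂ (fun a b => q.cond i.castSucc a b (u i)) 
      (Fin.take_snoc_of_le u v i i.2.le) (Fin.take_snoc_of_le y z i i.2.le)
  · rw [Fin.snoc_last]
    exact congrArg₂ (fun a b => q.cond (Fin.last N) a b v) 
      (Fin.take_snoc_of_le u v N le_rfl) (Fin.take_snoc_of_le y z N le_rfl)

end CausalDist

namespace FSC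

variable {X Y S U : Type*} [Fintype X] [Fintype Y] [Fintype S]
variable (W : FSC X Y S) (f : U → S → X)

/-- The probability `P(y^n || u^n)` of the outputs when the initial state is drawn from its
distribution. -/
noncomputable def avgLaw {n : ℕ} (u : Fin n → U) (y : Fin n → Y) : ℝ :=
  ∑ s, W.init s * W.outLaw f n s u y

theorem avgLaw_nonneg {n : ℕ} (u : Fin n → U) (y : Fin n → Y) : 0 ≤ W.avgLaw f u y :=
  Finset.sum_nonneg fun s _ => mul_nonneg (W.init_mem.1 s) (W.outLaw_nonneg f n s u y)

theorem avgLaw_le_one {n : ℕ} (u : Fin n → U) (y : Fin n → Y) : W.avgLaw f u y ≤ 1 := by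
  rw [← W.init_mem.2]
  exact Finset.sum_le_sum fun s _ =>
    mul_le_of_le_one_right (W.init_mem.1 s) (W.outLaw_le_one f n s u y)

theorem sum_avgLaw_snoc {n : ℕ} (u : Fin (n + 1) → U) (y : Fin n → Y) :
    ∑ z, W.avgLaw f u (Fin.snoc y z) = W.avgLaw f (Fin.init u) y := by
  simp only [avgLaw]
  rw [Finset.sum_comm]
  simp_rw [← Finset.mul_sum, sum_outLaw_snoc]

variable [Fintype U]

/-- The joint probability of `U^N` and `Y^N`. -/
noncomputable def jointLaw {N : ℕ} (q : CausalDist U Y N) (u : Fin N → U) (y : Fin N → Y) : ℝ :=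
  q.weight u y * W.avgLaw f u y

/-- The probability of an output sequence. -/
noncomputable def outMarginal {N : ℕ} (q : CausalDist U Y N) (y : Fin N → Y) : ℝ :=
  ∑ u, W.jointLaw f q u y

theorem jointLaw_nonneg {N : ℕ} (q : CausalDist U Y N) (u : Fin N → U) (y : Fin N → Y) :
    0 ≤ W.jointLaw f q u y := mul_nonneg (q.weight_nonneg u y) (W.avgLaw_nonneg f u y)

theorem sum_jointLaw_snoc {N : ℕ} (q : CausalDist U Y (N + 1)) (u : Fin N → U) (v : U)
    (y : Fin N → Y) : ∑ z, W.jointLaw f q (Fin.snoc u v) (Fin.snoc y z) =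
      (q.restrict N N.le_succ).weight u y * q.cond (Fin.last N) u y v * W.avgLaw f u y := by
  simp only [jointLaw, CausalDist.weight_snoc, ← Finset.mul_sum, sum_avgLaw_snoc, Fin.init_snoc]

theorem sum_jointLaw_mul_take {N : ℕ} (q : CausalDist U Y N) (k : ℕ) (h : k ≤ N)
    (G : (Fin k → U) → (Fin k → Y) → ℝ) :
    ∑ y, ∑ u, W.jointLaw f q u y * G (Fin.take k h u) (Fin.take k h y) =
      ∑ y, ∑ u, W.jointLaw f (q.restrict k h) u y * G u y := by
  induction N with
  | zero =>
    obtain rfl : k = 0 := by omega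
    rfl
  | succ N ih =>
    rcases h.eq_or_lt with rfl | hlt
    · rfl
    · have hk : k ≤ N := by omega
      refine Eq.trans ?_ (ih (q.restrict N N.le_succ) hk)
      rw [sum_fin_snoc]
      refine Finset.sum_congr rfl fun y _ => ?_
      simp only [sum_fin_snoc (A := U), Fin.take_snoc_of_le _ _ k hk]
      rw [Finset.sum_comm]
      refine Finset.sum_congr rfl fun u _ => ?_
      rw [Finset.sum_comm]
      simp only [← Finset.sum_mul, sum_jointLaw_snoc, ← Finset.mul_sum, (q.cond_mem _ _ _).2]
      rw [mul_one]
      rfl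

theorem sum_auxLaw_mul {N : ℕ} (q : CausalDist U Y N) (G : (Fin N → U) → (Fin N → Y) → ℝ) :
    ∑ ω, W.auxLaw f q ω * G ω.2.2 ω.2.1 = ∑ y, ∑ u, W.jointLaw f q u y * G u y := by
  rw [Fintype.sum_prod_type, Finset.sum_comm, Fintype.sum_prod_type]
  refine Finset.sum_congr rfl fun y _ => Finset.sum_congr rfl fun u _ => ?_
  dsimp only
  rw [← Finset.sum_mul, jointLaw, avgLaw, ← sum_states_eq_outLaw, Finset.mul_sum]
  congr 1
  refine Finset.sum_congr rfl fun s _ => ?_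
  simp only [auxLaw, CausalDist.weight]
  ring

open Classical in
/-- The probability of an event that depends only on the first `k` inputs and outputs. -/
theorem probEq_auxLaw {N : ℕ} (q : CausalDist U Y N) (k : ℕ) (h : k ≤ N) {A : Type*}
    (F : (Fin N → U) × (Fin N → Y) → A) (G : (Fin k → U) → (Fin k → Y) → Prop) (a : A)
    (hFG : ∀ u y, F (u, y) = a ↔ G (Fin.take k h u) (Fin.take k h y)) :
    probEq (W.auxLaw f q) (fun ω => F (ω.2.2, ω.2.1)) a =
      ∑ y, ∑ u, W.jointLaw f (q.restrict k h) u y * if G u y then 1 else 0 := by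
  rw [← sum_jointLaw_mul_take W f q k h fun u y => if G u y then 1 else 0, ← sum_auxLaw_mul W f q
    (fun u y => if G (Fin.take k h u) (Fin.take k h y) then 1 else 0)]
  refine Finset.sum_congr rfl fun ω _ => ?_
  simp only [hFG, mul_ite, mul_one, mul_zero]

theorem probEq_joint {N : ℕ} (q : CausalDist U Y N) (i : Fin N) (u : Fin N → U) (y : Fin N → Y) :
    probEq (W.auxLaw f q) (fun ω => (Fin.take (i + 1) i.2 ω.2.2, ω.2.1 i,
      Fin.take i i.2.le ω.2.1)) (Fin.take (i + 1) i.2 u, y i, Fin.take i i.2.le y) =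
    W.jointLaw f (q.restrict (i + 1) i.2) (Fin.take (i + 1) i.2 u) (Fin.take (i + 1) i.2 y) := by
  classical
  rw [W.probEq_auxLaw f q (i + 1) i.2
    (fun w => (Fin.take (i + 1) i.2 w.1, w.2 i, Fin.take i i.2.le w.2))
    (fun a b => a = Fin.take (i + 1) i.2 u ∧ b = Fin.take (i + 1) i.2 y)
    _ (fun u' y' => by simp only [Prod.mk.injEq, Fin.take_succ_eq_iff i y' y])]
  simp [ite_and]

theorem probEq_output {N : ℕ} (q : CausalDist U Y N) (k : ℕ) (h : k ≤ N) (y : Fin N → Y) :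
    probEq (W.auxLaw f q) (fun ω => Fin.take k h ω.2.1) (Fin.take k h y) =
      W.outMarginal f (q.restrict k h) (Fin.take k h y) := by
  classical
  rw [W.probEq_auxLaw f q k h (fun w => Fin.take k h w.2) (fun a b => b = Fin.take k h y) _
    (fun u' y' => Iff.rfl)]
  simp only [mul_ite, mul_one, mul_zero]
  rw [Finset.sum_eq_single (Fin.take k h y) (fun b _ hb => by simp [hb]) (by simp)]
  simp [outMarginal]

theorem probEq_output_succ {N : ℕ} (q : CausalDist U Y N) (i : Fin N) (y : Fin N → Y) :
    probEq (W.auxLaw f q) (fun ω => (ω.2.1 i, Fin.take i i.2.le ω.2.1))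
      (y i, Fin.take i i.2.le y) =
      W.outMarginal f (q.restrict (i + 1) i.2) (Fin.take (i + 1) i.2 y) := by
  rw [← probEq_output]
  refine Finset.sum_congr rfl fun ω _ => ?_
  have h : (ω.2.1 i, Fin.take i i.2.le ω.2.1) = (y i, Fin.take i i.2.le y) ↔
      Fin.take (i + 1) i.2 ω.2.1 = Fin.take (i + 1) i.2 y := by
    rw [Prod.mk.injEq, Fin.take_succ_eq_iff]
  by_cases h1 : Fin.take (i + 1) i.2 ω.2.1 = Fin.take (i + 1) i.2 y
  · rw [if_pos h1, if_pos (h.2 h1)]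
  · rw [if_neg h1, if_neg (mt h.1 h1)]

theorem probEq_input {N : ℕ} (q : CausalDist U Y N) (i : Fin N) (u : Fin N → U) (y : Fin N → Y) :
    probEq (W.auxLaw f q) (fun ω => (Fin.take (i + 1) i.2 ω.2.2, Fin.take i i.2.le ω.2.1))
      (Fin.take (i + 1) i.2 u, Fin.take i i.2.le y) =
    (q.restrict (i + 1) i.2).weight (Fin.take (i + 1) i.2 u) (Fin.take (i + 1) i.2 y) *
      W.avgLaw f (Fin.take i i.2.le u) (Fin.take i i.2.le y) := by
  classical
  rw [W.probEq_auxLaw f q (i + 1) i.2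
    (fun w => (Fin.take (i + 1) i.2 w.1, Fin.take i i.2.le w.2))
    (fun a b => a = Fin.take (i + 1) i.2 u ∧ Fin.init b = Fin.take i i.2.le y)
    _ (fun u' y' => Prod.mk.injEq _ _ _ _ ▸ Iff.rfl)]
  rw [Fin.take_succ_eq_snoc i i.2 u, Fin.take_succ_eq_snoc i i.2 y, CausalDist.weight_snoc, ← sum_jointLaw_snoc, sum_fin_snoc]
  rw [Finset.sum_eq_single (Fin.take i i.2.le y) (fun b _ hb => by simp [hb]) (by simp)]
  refine Finset.sum_congr rfl fun z _ => ?_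
  simp

theorem logb_ratio_telescope {a b c d w : ℝ} (ha : 0 < a) (hb : 0 < b) (hc : 0 < c) (hd : 0 < d)
    (hw : 0 < w) : Real.logb 2 (w * a * d / (w * c * b)) =
      Real.logb 2 (a / b) - Real.logb 2 (c / d) := by
  rw [← Real.logb_div (by positivity) (by positivity)]
  congr 1
  field_simp

/-- The directed information is the expectation of `log₂ (P(y^N || u^N) / P(y^N))`: the terms of its
definition telescope, since `P(y_i | u^i, y^{i-1})` is a quotient of two successive values of
`P(y^k || u^k)`. -/
theorem auxDirectedInfo_eq {N : ℕ} (q : CausalDist U Y N) :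
    W.auxDirectedInfo f q = ∑ y, ∑ u, W.jointLaw f q u y *
      Real.logb 2 (W.avgLaw f u y / W.outMarginal f q y) := by
  rw [← sum_auxLaw_mul W f q (fun u y => Real.logb 2 (W.avgLaw f u y / W.outMarginal f q y)),
    auxDirectedInfo, directedInfo]
  simp only [condMutualInfo]
  rw [Finset.sum_comm]
  refine Finset.sum_congr rfl fun ω _ => ?_
  rw [← Finset.mul_sum]
  rcases eq_or_ne (W.auxLaw f q ω) 0 with h0 | h0
  · rw [h0, zero_mul, zero_mul]
  congr 1
  obtain ⟨s, y, u⟩ := ω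
  dsimp only
  have hp : ∀ ω, 0 ≤ W.auxLaw f q ω := fun ω => mul_nonneg (mul_nonneg (W.init_mem.1 _)
    (Finset.prod_nonneg fun i _ => (q.cond_mem i _ _).1 _))
    (Finset.prod_nonneg fun i _ => W.kernel_nonneg _ _ _)
  have hJ : ∀ k (h : k ≤ N),
      0 < W.jointLaw f (q.restrict k h) (Fin.take k h u) (Fin.take k h y) := by
    classical
    intro k h
    have h1 := sum_jointLaw_mul_take W f q k h
      (fun a b => if a = Fin.take k h u ∧ b = Fin.take k h y then 1 else 0)
    rw [← sum_auxLaw_mul W f q (fun u' y' => if Fin.take k h u' = Fin.take k h u ∧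
      Fin.take k h y' = Fin.take k h y then 1 else 0)] at h1
    have h2 : ∑ b, ∑ a, W.jointLaw f (q.restrict k h) a b *
        (if a = Fin.take k h u ∧ b = Fin.take k h y then 1 else 0) =
        W.jointLaw f (q.restrict k h) (Fin.take k h u) (Fin.take k h y) := by simp [ite_and]
    rw [← h2, ← h1]
    refine lt_of_lt_of_le ?_ (Finset.single_le_sum (fun ω _ => ?_) (Finset.mem_univ (s, y, u)))
    · simpa using lt_of_le_of_ne (hp _) h0.symm
    · exact mul_nonneg (hp ω) (by split_ifs <;> norm_num)
  have hw : ∀ k (h : k ≤ N), 0 < (q.restrict k h).weight (Fin.take k h u) (Fin.take k h y) ∧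
      0 < W.avgLaw f (Fin.take k h u) (Fin.take k h y) := fun k h =>
    ⟨pos_of_mul_pos_left (hJ k h) (W.avgLaw_nonneg f _ _),
      pos_of_mul_pos_right (hJ k h) (CausalDist.weight_nonneg _ _ _)⟩
  have hP : ∀ k (h : k ≤ N), 0 < W.outMarginal f (q.restrict k h) (Fin.take k h y) := fun k h =>
    (hJ k h).trans_le (Finset.single_le_sum (f := fun u => W.jointLaw f (q.restrict k h) u
      (Fin.take k h y)) (fun u _ => W.jointLaw_nonneg f _ _ _) (Finset.mem_univ _))
  -- Off the range `k ≤ N` the value is irrelevant.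
  let φ : ℕ → ℝ := fun k => if h : k ≤ N then Real.logb 2 (W.avgLaw f (Fin.take k h u)
    (Fin.take k h y) / W.outMarginal f (q.restrict k h) (Fin.take k h y)) else 0
  have hφ : ∀ i : Fin N, φ (i + 1) - φ i = Real.logb 2
      (probEq (W.auxLaw f q) (fun ω => (Fin.take (i + 1) i.2 ω.2.2, ω.2.1 i,
        Fin.take i i.2.le ω.2.1)) (Fin.take (i + 1) i.2 u, y i, Fin.take i i.2.le y) *
      probEq (W.auxLaw f q) (fun ω => Fin.take i i.2.le ω.2.1) (Fin.take i i.2.le y) /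
      (probEq (W.auxLaw f q) (fun ω => (Fin.take (i + 1) i.2 ω.2.2, Fin.take i i.2.le ω.2.1))
        (Fin.take (i + 1) i.2 u, Fin.take i i.2.le y) *
      probEq (W.auxLaw f q) (fun ω => (ω.2.1 i, Fin.take i i.2.le ω.2.1))
        (y i, Fin.take i i.2.le y))) := by
    intro i
    rw [probEq_joint, probEq_output, probEq_output_succ, probEq_input, jointLaw,
      logb_ratio_telescope (hw _ _).2 (hP _ _) (hw _ _).2 (hP _ _) (hw _ _).1]
    simp only [φ, dif_pos (show (i : ℕ) + 1 ≤ N from i.2), dif_pos i.2.le]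
  rw [← Finset.sum_congr rfl fun i _ => hφ i,
    Fin.sum_univ_eq_sum_range (fun k => φ (k + 1) - φ k) N, Finset.sum_range_sub]
  have h0 : φ 0 = 0 := by
    simp [φ, avgLaw, outMarginal, jointLaw, outLaw, CausalDist.weight, W.init_mem.2]
  have hN : φ N = Real.logb 2 (W.avgLaw f u y / W.outMarginal f q y) := by
    simp only [φ, dif_pos le_rfl]
    rfl
  rw [h0, hN, sub_zero]

end FSC

/-! ### Causally conditional distributions and random code trees -/

theorem treePath_cons {U Y : Type*} (t : List Y → U) {n : ℕ} (z : Y) (y : Fin n → Y) :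
    treePath t (Fin.cons z y : Fin (n + 1) → Y) =
      Fin.cons (t []) (treePath (fun l => t (z :: l)) y) := by
  funext i
  refine Fin.cases rfl (fun i => ?_) i
  rw [Fin.cons_succ]
  exact congrArg t List.ofFn_succ

theorem Fin.take_succ_cons {A : Type*} {N : ℕ} (a : A) (b : Fin N → A) (i : Fin N) :
    Fin.take (i + 1) i.succ.2.le (Fin.cons a b : Fin (N + 1) → A) =
      (Fin.cons a (Fin.take i i.2.le b) : Fin (i + 1) → A) := by
  funext j
  refine Fin.cases rfl (fun j => rfl) j

namespace CausalDist

variable {U Y : Type*} [Fintype U] {N : ℕ}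

/-- What remains of a causally conditional distribution after a first input and output. -/
def shift (q : CausalDist U Y (N + 1)) (u₀ : U) (y₀ : Y) : CausalDist U Y N where
  cond i u y := q.cond i.succ (Fin.cons u₀ u) (Fin.cons y₀ y)
  cond_mem _ _ _ := q.cond_mem _ _ _

theorem weight_cons (q : CausalDist U Y (N + 1)) (u₀ : U) (u : Fin N → U) (y₀ : Y)
    (y : Fin N → Y) : q.weight (Fin.cons u₀ u) (Fin.cons y₀ y) =
      q.cond 0 Fin.elim0 Fin.elim0 u₀ * (q.shift u₀ y₀).weight u y := by
  rw [weight, Fin.prod_univ_succ]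
  congr 1
  · exact congrArg₂ (fun a b => q.cond 0 a b u₀) (Subsingleton.elim (α := Fin 0 → U) _ _)
      (Subsingleton.elim (α := Fin 0 → Y) _ _)
  · refine Finset.prod_congr rfl fun i _ => ?_
    exact congrArg₂ (fun a b => q.cond i.succ a b (u i)) 
      (Fin.take_succ_cons u₀ u i) (Fin.take_succ_cons y₀ y i)

/-- `q` is the law of the inputs prescribed by a random code tree `t a`, where `a` has law `p`. -/
def IsTreeMixture {A : Type*} [Fintype A] (q : CausalDist U Y N) (p : A → ℝ)
    (t : A → List Y → U) : Prop :=
  ∀ (y : Fin N → Y) (G : (Fin N → U) → ℝ),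
    ∑ u, q.weight u y * G u = ∑ a, p a * G (treePath (t a) y)

/-- Every causally conditional distribution is the law of the inputs along a random code tree. The
tree is built from its root: below the root, there is one independent random subtree for each
choice of the first input and output. -/
theorem exists_isTreeMixture [Fintype Y] [Nonempty U] (q : CausalDist U Y N) :
    ∃ (k : ℕ) (p : Fin k → ℝ) (t : Fin k → List Y → U),
      p ∈ stdSimplex ℝ (Fin k) ∧ q.IsTreeMixture p t := by
  induction N with
  | zero =>
    refine ⟨1, fun _ => 1, fun _ _ => Classical.arbitrary U, ⟨fun _ => zero_le_one, by simp⟩, ?_⟩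
    intro y G
    simp only [Fintype.sum_unique, weight, Finset.univ_eq_empty, Finset.prod_empty, one_mul]
    exact congrArg G (Subsingleton.elim _ _)
  | succ N ih =>
    classical
    choose k p t hp ht using fun z : U × Y => ih (q.shift z.1 z.2)
    let e := Fintype.equivFin (U × ∀ z : U × Y, Fin (k z))
    let p' : U × (∀ z : U × Y, Fin (k z)) → ℝ := fun a =>
      q.cond 0 Fin.elim0 Fin.elim0 a.1 * ∏ z, p z (a.2 z)
    let t' : U × (∀ z : U × Y, Fin (k z)) → List Y → U := fun a l => match l with
      | [] => a.1
      | z :: l => t (a.1, z) (a.2 (a.1, z)) l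
    have hpi := pi_prod_mem_stdSimplex p hp
    refine ⟨_, fun j => p' (e.symm j), fun j => t' (e.symm j), ⟨fun j => ?_, ?_⟩, fun y G => ?_⟩
    · exact mul_nonneg ((q.cond_mem _ _ _).1 _) (hpi.1 _)
    · rw [e.symm.sum_comp p', Fintype.sum_prod_type]
      simp only [p', ← Finset.mul_sum, hpi.2, mul_one]
      exact (q.cond_mem 0 _ _).2
    · rw [e.symm.sum_comp (fun a => p' a * G (treePath (t' a) y)), Fintype.sum_prod_type,
        sum_fin_cons]
      refine Finset.sum_congr rfl fun u₀ _ => ?_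
      obtain ⟨y₀, y, rfl⟩ : ∃ y₀ y', y = Fin.cons y₀ y' := ⟨y 0, Fin.tail y, by simp⟩
      simp only [weight_cons, mul_assoc, ← Finset.mul_sum, p']
      rw [ht (u₀, y₀) y (fun u => G (Fin.cons u₀ u))]
      simp only [treePath_cons]
      rw [← sum_pi_prod_mul_apply p (fun z => (hp z).2) (u₀, y₀)
        (fun a => G (Fin.cons u₀ (treePath (t (u₀, y₀) a) y)))]

open Classical in
/-- The inputs along a random code tree follow a causally conditional distribution; its factors are
the conditional probabilities, and they are uniform where the conditioning event is null. -/
theorem exists_isTreeMixture_of_trees [Nonempty U] {A : Type*} [Fintype A] (p : A → ℝ)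
    (hp : p ∈ stdSimplex ℝ A) (t : A → List Y → U) (N : ℕ) :
    ∃ q : CausalDist U Y N, q.IsTreeMixture p t := by
  -- the probability that the inputs prescribed along `y` begin with `u`
  let D : (i : ℕ) → (Fin i → U) → (Fin i → Y) → ℝ := fun i u y =>
    ∑ a, p a * if treePath (t a) y = u then 1 else 0
  -- the probability that they begin with `u`, followed by `v`
  let D' : (i : ℕ) → (Fin i → U) → (Fin i → Y) → U → ℝ := fun i u y v =>
    ∑ a, p a * if treePath (t a) y = u ∧ t a (List.ofFn y) = v then 1 else 0
  have hD0 : ∀ i u y, 0 ≤ D i u y := fun i u y => Finset.sum_nonneg fun a _ =>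
    mul_nonneg (hp.1 a) (by split_ifs <;> norm_num)
  have hD0' : ∀ i u y v, 0 ≤ D' i u y v := fun i u y v => Finset.sum_nonneg fun a _ =>
    mul_nonneg (hp.1 a) (by split_ifs <;> norm_num)
  have hDD : ∀ i u y, ∑ v, D' i u y v = D i u y := by
    intro i u y
    simp only [D, D']
    rw [Finset.sum_comm]
    simp [ite_and]
  let q : CausalDist U Y N :=
    { cond := fun i u y v => if D i u y = 0 then (Fintype.card U : ℝ)⁻¹ else D' i u y v / D i u y
      cond_mem := fun i u y => by
        by_cases h : D i u y = 0
        · simp only [if_pos h]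
          exact ⟨fun _ => by positivity, by simp⟩
        · simp only [if_neg h]
          refine ⟨fun v => div_nonneg (hD0' _ _ _ _) (hD0 _ _ _), ?_⟩
          rw [← Finset.sum_div, hDD, div_self h] }
  have hq : ∀ (u : Fin N → U) (y : Fin N → Y) (k : ℕ) (h : k ≤ N),
      (q.restrict k h).weight (Fin.take k h u) (Fin.take k h y) =
        D k (Fin.take k h u) (Fin.take k h y) := by
    intro u y k
    induction k with
    | zero =>
      intro h
      have : ∀ a, treePath (t a) (Fin.take 0 h y) = Fin.take 0 h u := fun a => Subsingleton.elim _ _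
      simp only [weight, D, this, if_true, mul_one, hp.2, Finset.univ_eq_empty,
        Finset.prod_empty]
    | succ k ih =>
      intro h
      have h' : k ≤ N := by omega
      have hp1 : ∀ a, treePath (t a) (Fin.take (k + 1) h y) = Fin.take (k + 1) h u ↔
          treePath (t a) (Fin.take k h' y) = Fin.take k h' u ∧
            t a (List.ofFn (Fin.take k h' y)) = u ⟨k, h⟩ := by
        intro a
        constructor
        · intro hh
          exact ⟨funext fun j => congrFun hh j.castSucc, congrFun hh (Fin.last k)⟩
        · rintro ⟨h1, h2⟩
          funext j
          refine Fin.lastCases h2 (fun j => congrFun h1 j) j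
      have hDs : D (k + 1) (Fin.take (k + 1) h u) (Fin.take (k + 1) h y) =
          D' k (Fin.take k h' u) (Fin.take k h' y) (u ⟨k, h⟩) := by
        simp only [D, D', hp1]
      rw [hDs, Fin.take_succ_eq_snoc k h u, Fin.take_succ_eq_snoc k h y, weight_snoc]
      have h3 : (((q.restrict (k + 1) h).restrict k k.le_succ).weight (Fin.take k h' u)
        (Fin.take k h' y)) = _ := ih h'
      rw [h3]
      change D k (Fin.take k h' u) (Fin.take k h' y) *
        (if D k (Fin.take k h' u) (Fin.take k h' y) = 0 then (Fintype.card U : ℝ)⁻¹ else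
          D' k (Fin.take k h' u) (Fin.take k h' y) (u ⟨k, h⟩) /
            D k (Fin.take k h' u) (Fin.take k h' y)) = _
      by_cases h0 : D k (Fin.take k h' u) (Fin.take k h' y) = 0
      · rw [h0, zero_mul]
        have := hDD k (Fin.take k h' u) (Fin.take k h' y)
        rw [h0, Finset.sum_eq_zero_iff_of_nonneg fun v _ => hD0' _ _ _ _] at this
        exact (this _ (Finset.mem_univ _)).symm
      · rw [if_neg h0]
        field_simp
  refine ⟨q, fun y G => ?_⟩
  have hq' : ∀ u, q.weight u y = ∑ a, p a * if treePath (t a) y = u then 1 else 0 :=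
    fun u => hq u y N le_rfl
  simp only [hq', Finset.sum_mul]
  rw [Finset.sum_comm]
  simp

end CausalDist

namespace FSC

variable {X Y S U : Type*} [Fintype X] [Fintype Y] [Fintype S]
variable (W : FSC X Y S) (f : U → S → X)

/-- The probability of a list of outputs when the initial state has its own distribution and the
encoder follows a code tree. -/
noncomputable def avgTreeLaw (t : List Y → U) (l : List Y) : ℝ :=
  ∑ s, W.init s * W.treeLaw f s t l

theorem avgTreeLaw_ofFn (t : List Y → U) {n : ℕ} (y : Fin n → Y) :
    W.avgTreeLaw f t (List.ofFn y) = W.avgLaw f (treePath t y) y := by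
  simp only [avgTreeLaw, avgLaw, treeLaw_ofFn]

theorem avgTreeLaw_mem_stdSimplex (n : ℕ) (t : List Y → U) :
    (fun y : Fin n → Y => W.avgTreeLaw f t (List.ofFn y)) ∈ stdSimplex ℝ (Fin n → Y) := by
  refine ⟨fun y => Finset.sum_nonneg fun s _ => mul_nonneg (W.init_mem.1 s)
    (W.treeLaw_nonneg f s t _), ?_⟩
  simp only [avgTreeLaw]
  rw [Finset.sum_comm]
  simp only [← Finset.mul_sum, sum_treeLaw, mul_one, W.init_mem.2]

variable [Fintype U]

/-! ### Maximizing the directed information -/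

theorem outMarginal_nonneg {N : ℕ} (q : CausalDist U Y N) (y : Fin N → Y) :
    0 ≤ W.outMarginal f q y := Finset.sum_nonneg fun u _ => W.jointLaw_nonneg f q u y

theorem sum_outMarginal {N : ℕ} (q : CausalDist U Y N) : ∑ y, W.outMarginal f q y = 1 := by
  have := sum_jointLaw_mul_take W f q 0 N.zero_le (fun _ _ => 1)
  simpa [outMarginal, jointLaw, avgLaw, outLaw, CausalDist.weight, W.init_mem.2] using this

theorem jointLaw_le_outMarginal {N : ℕ} (q : CausalDist U Y N) (u : Fin N → U) (y : Fin N → Y) :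
    W.jointLaw f q u y ≤ W.outMarginal f q y :=
  Finset.single_le_sum (f := fun u => W.jointLaw f q u y)
    (fun u _ => W.jointLaw_nonneg f q u y) (Finset.mem_univ u)

/-- This form of the directed information is visibly continuous in the distribution of the inputs. -/
theorem auxDirectedInfo_eq_sub {N : ℕ} (q : CausalDist U Y N) :
    W.auxDirectedInfo f q = ∑ y, ∑ u, W.jointLaw f q u y * Real.logb 2 (W.avgLaw f u y) -
      ∑ y, W.outMarginal f q y * Real.logb 2 (W.outMarginal f q y) := by
  rw [auxDirectedInfo_eq, ← Finset.sum_sub_distrib]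
  refine Finset.sum_congr rfl fun y _ => ?_
  nth_rw 2 [outMarginal]
  rw [Finset.sum_mul, ← Finset.sum_sub_distrib]
  refine Finset.sum_congr rfl fun u _ => ?_
  rw [← mul_sub]
  rcases (W.jointLaw_nonneg f q u y).eq_or_lt' with h | h
  · rw [h, zero_mul, zero_mul]
  · rw [Real.logb_div (right_ne_zero_of_mul h.ne')
      (h.trans_le (W.jointLaw_le_outMarginal f q u y)).ne']

theorem auxDirectedInfo_le {N : ℕ} (q : CausalDist U Y N) :
    W.auxDirectedInfo f q ≤ N * Real.logb 2 (Fintype.card Y) := by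
  have hY : 0 < N → 0 < Fintype.card Y := by
    intro hN
    by_contra h
    have hE : IsEmpty Y := Fintype.card_eq_zero_iff.1 (by omega)
    have : IsEmpty (Fin N → Y) := ⟨fun y => hE.false (y ⟨0, hN⟩)⟩
    have := W.sum_outMarginal f q
    simp at this
  have hc : (0 : ℝ) < (Fintype.card Y : ℝ) ^ N := by
    rcases N.eq_zero_or_pos with rfl | hN
    · simp
    · have := hY hN
      positivity
  -- The entropy of the outputs is at most that of the uniform distribution.
  have h1 := sum_mul_logb_le (W.outMarginal f q) (fun _ => 1)
    (fun _ => ((Fintype.card Y : ℝ) ^ N)⁻¹) (W.outMarginal_nonneg f q) (fun _ => zero_le_one)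
    (fun _ => by positivity) (fun _ _ => ⟨one_ne_zero, by positivity⟩) (by
      rw [sum_outMarginal]
      simp only [one_mul, Finset.sum_const, Finset.card_univ, Fintype.card_fun, Fintype.card_fin,
        nsmul_eq_mul, Nat.cast_pow]
      exact (mul_inv_cancel₀ hc.ne').le)
  rw [← Finset.sum_mul, sum_outMarginal, one_mul, Real.logb_inv, Real.logb_pow] at h1
  simp only [div_one] at h1
  have h2 : ∑ y, ∑ u, W.jointLaw f q u y * Real.logb 2 (W.avgLaw f u y) ≤ 0 :=
    Finset.sum_nonpos fun y _ => Finset.sum_nonpos fun u _ =>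
      mul_nonpos_of_nonneg_of_nonpos (W.jointLaw_nonneg f q u y)
        (Real.logb_nonpos (by norm_num) (W.avgLaw_nonneg f u y) (W.avgLaw_le_one f u y))
  rw [auxDirectedInfo_eq_sub]
  linarith

theorem isGreatest_maxDirectedInfo [Nonempty U] (N : ℕ) :
    IsGreatest (Set.range fun q : CausalDist U Y N => W.auxDirectedInfo f q)
      (W.maxDirectedInfo f N) := by
  let E := (i : Fin N) → (Fin i → U) → (Fin i → Y) → U → ℝ
  let K : Set E := Set.univ.pi fun i => Set.univ.pi fun u => Set.univ.pi fun y => stdSimplex ℝ U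
  have hK : IsCompact K := isCompact_univ_pi fun i => isCompact_univ_pi fun u =>
    isCompact_univ_pi fun y => isCompact_stdSimplex ℝ U
  let w : E → (Fin N → U) → (Fin N → Y) → ℝ := fun c u y =>
    (∏ i : Fin N, c i (Fin.take i i.2.le u) (Fin.take i i.2.le y) (u i)) * W.avgLaw f u y
  let Φ : E → ℝ := fun c => ∑ y, ∑ u, w c u y * Real.logb 2 (W.avgLaw f u y) -
      ∑ y, (∑ u, w c u y) * Real.logb 2 (∑ u, w c u y)
  have hw : ∀ u y, Continuous fun c => w c u y := by
    intro u y
    simp only [w, E]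
    fun_prop
  have hlog : Continuous fun x : ℝ => x * Real.logb 2 x := by
    simp only [Real.logb, mul_div_assoc']
    exact Real.continuous_mul_log.div_const _
  have hΦ : Continuous Φ := by
    refine (continuous_finsetSum _ fun y _ => continuous_finsetSum _ fun u _ =>
      (hw u y).mul_const _).sub (continuous_finsetSum _ fun y _ => ?_)
    exact hlog.comp (continuous_finsetSum _ fun u _ => hw u y)
  have hq : ∀ q : CausalDist U Y N, q.cond ∈ K ∧ W.auxDirectedInfo f q = Φ q.cond := fun q =>
    ⟨fun i _ u _ y _ => q.cond_mem i u y, W.auxDirectedInfo_eq_sub f q⟩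
  have hne : K.Nonempty := ⟨fun _ _ _ _ => (Fintype.card U : ℝ)⁻¹,
    fun i _ u _ y _ => ⟨fun _ => by positivity, by simp⟩⟩
  obtain ⟨c, hc, hmax⟩ := hK.exists_isMaxOn hne hΦ.continuousOn
  let q₀ : CausalDist U Y N := ⟨c, fun i u y => hc i trivial u trivial y trivial⟩
  have hg : IsGreatest (Set.range fun q : CausalDist U Y N => W.auxDirectedInfo f q)
      (W.auxDirectedInfo f q₀) := by
    refine ⟨⟨q₀, rfl⟩, ?_⟩
    rintro _ ⟨q, rfl⟩
    dsimp only
    rw [(hq q).2, (hq q₀).2]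
    exact hmax (hq q).1
  rw [maxDirectedInfo, hg.csSup_eq]
  exact hg

/-- The directed information is the mutual information between a random code tree and the outputs. -/
theorem auxDirectedInfo_eq_of_isTreeMixture {N : ℕ} {q : CausalDist U Y N} {A : Type*} [Fintype A]
    {p : A → ℝ} {t : A → List Y → U} (h : q.IsTreeMixture p t) :
    W.auxDirectedInfo f q = ∑ y : Fin N → Y, ∑ a, p a * (W.avgTreeLaw f (t a) (List.ofFn y) *
      Real.logb 2 (W.avgTreeLaw f (t a) (List.ofFn y) /
        ∑ b, p b * W.avgTreeLaw f (t b) (List.ofFn y))) := by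
  rw [auxDirectedInfo_eq]
  refine Finset.sum_congr rfl fun y _ => ?_
  have h1 : W.outMarginal f q y = ∑ b, p b * W.avgTreeLaw f (t b) (List.ofFn y) := by
    simp only [outMarginal, jointLaw, avgTreeLaw_ofFn]
    exact h y fun u => W.avgLaw f u y
  simp only [h1, avgTreeLaw_ofFn, jointLaw, mul_assoc]
  exact h y fun u => W.avgLaw f u y * _

end FSC

/-! ### Scores of blocks -/

/-- The product of the scores of the blocks of length `L` of a list of outputs. -/
noncomputable def scoreProd {A Y : Type*} (L : ℕ) (z : A → List Y → ℝ) : List A → List Y → ℝ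
  | [], _ => 1
  | a :: as, l => z a (l.take L) * scoreProd L z as (l.drop L)

theorem scoreProd_pos {A Y : Type*} (L : ℕ) {z : A → List Y → ℝ} (hz : ∀ a l, 0 < z a l)
    (as : List A) (l : List Y) : 0 < scoreProd L z as l := by
  induction as generalizing l with
  | nil => exact zero_lt_one
  | cons a as ih => exact mul_pos (hz _ _) (ih _)

theorem sum_scoreProd_le {A Y : Type*} [Fintype A] (L : ℕ) {z : A → List Y → ℝ}
    (hz : ∀ a l, 0 < z a l) {p : A → ℝ} (hp : ∀ a, 0 ≤ p a) {c : ℝ}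
    (hc : ∀ l, ∑ a, p a * z a l ≤ c) (B : ℕ) (l : List Y) :
    ∑ b : Fin B → A, (∏ j, p (b j)) * scoreProd L z (List.ofFn b) l ≤ c ^ B := by
  induction B generalizing l with
  | zero => simp [scoreProd]
  | succ B ih =>
    have hc0 : 0 ≤ c := (Finset.sum_nonneg fun a _ => mul_nonneg (hp a) (hz a []).le).trans (hc [])
    rw [sum_fin_cons]
    calc _ = ∑ a, p a * z a (l.take L) * ∑ b : Fin B → A, (∏ j, p (b j)) *
            scoreProd L z (List.ofFn b) (l.drop L) := by
          refine Finset.sum_congr rfl fun a _ => ?_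
          rw [Finset.mul_sum]
          refine Finset.sum_congr rfl fun b _ => ?_
          rw [Fin.prod_univ_succ, List.ofFn_cons, scoreProd]
          simp only [Fin.cons_zero, Fin.cons_succ]
          ring
      _ ≤ ∑ a, p a * z a (l.take L) * c ^ B := by
          refine Finset.sum_le_sum fun a _ => ?_
          exact mul_le_mul_of_nonneg_left (ih _) (mul_nonneg (hp a) (hz _ _).le)
      _ ≤ c ^ (B + 1) := by
          rw [← Finset.sum_mul, pow_succ']
          exact mul_le_mul_of_nonneg_right (hc _) (by positivity)

namespace FSC

/-! ### Steering the channel to a given state -/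

section Steering

variable {X Y S : Type*} [Fintype X] [Fintype Y] [Fintype S]

open Classical in
/-- The largest probability with which an encoder that sees the state can bring the channel from
state `s` to the state `r` within `n` steps. -/
noncomputable def hitProb (W : FSC X Y S) (r : S) : ℕ → S → ℝ
  | 0, s => if s = r then 1 else 0
  | n + 1, s => if s = r then 1 else ⨆ x, ∑ y, ∑ s', W.kernel x s (y, s') * W.hitProb r n s'

variable (W : FSC X Y S)

theorem hitProb_self (r : S) (n : ℕ) : W.hitProb r n r = 1 := by
  cases n <;> simp [hitProb]

theorem le_hitProb_succ (r : S) (n : ℕ) {s : S} (hs : s ≠ r) (x : X) :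
    ∑ y, ∑ s', W.kernel x s (y, s') * W.hitProb r n s' ≤ W.hitProb r (n + 1) s := by
  rw [hitProb, if_neg hs]
  exact le_ciSup (f := fun x => ∑ y, ∑ s', W.kernel x s (y, s') * W.hitProb r n s')
    (Set.finite_range _).bddAbove x

theorem exists_hitProb_succ_eq [Nonempty X] (r : S) (n : ℕ) {s : S} (hs : s ≠ r) :
    ∃ x, ∑ y, ∑ s', W.kernel x s (y, s') * W.hitProb r n s' = W.hitProb r (n + 1) s := by
  rw [hitProb, if_neg hs]
  exact exists_eq_ciSup_of_finite

theorem hitProb_nonneg [Nonempty X] (r : S) (n : ℕ) (s : S) : 0 ≤ W.hitProb r n s := by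
  induction n generalizing s with
  | zero => rw [hitProb]; split_ifs <;> norm_num
  | succ n ih =>
    rcases eq_or_ne s r with rfl | hs
    · rw [hitProb_self]; exact zero_le_one
    · refine le_trans ?_ (W.le_hitProb_succ r n hs (Classical.arbitrary X))
      exact Finset.sum_nonneg fun y _ => Finset.sum_nonneg fun s' _ =>
        mul_nonneg (W.kernel_nonneg _ _ _) (ih s')

theorem hitProb_le_one [Nonempty X] (r : S) (n : ℕ) (s : S) : W.hitProb r n s ≤ 1 := by
  induction n generalizing s with
  | zero => rw [hitProb]; split_ifs <;> norm_num
  | succ n ih =>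
    rcases eq_or_ne s r with rfl | hs
    · rw [hitProb_self]
    · obtain ⟨x, hx⟩ := W.exists_hitProb_succ_eq r n hs
      rw [← hx]
      exact (W.kernel_avg_le fun y s' => ih s').trans_eq (W.kernel_avg_const x s 1)

theorem hitProb_monotone [Nonempty X] (r s : S) : Monotone fun n => W.hitProb r n s := by
  refine monotone_nat_of_le_succ fun n => ?_
  induction n generalizing s with
  | zero =>
    rcases eq_or_ne s r with rfl | hs
    · simp only [hitProb_self]; exact le_rfl
    · simpa [hitProb, hs] using W.hitProb_nonneg r 1 s
  | succ n ih =>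
    rcases eq_or_ne s r with rfl | hs
    · simp only [hitProb_self]; exact le_rfl
    · obtain ⟨x, hx⟩ := W.exists_hitProb_succ_eq r n hs
      rw [← hx]
      exact (W.kernel_avg_le fun y s' => ih s').trans (W.le_hitProb_succ r (n + 1) hs x)

/-- In a strongly connected channel, the encoder can reach every state with probability arbitrarily
close to one. -/
theorem tendsto_hitProb [Nonempty X] (hW : W.StronglyConnected) (r s : S) :
    Tendsto (fun n => W.hitProb r n s) atTop (𝓝 1) := by
  have hlim : ∀ s, ∃ h, Tendsto (fun n => W.hitProb r n s) atTop (𝓝 h) := fun s =>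
    ⟨_, tendsto_atTop_ciSup (W.hitProb_monotone r s) ⟨1, by
      rintro _ ⟨n, rfl⟩; exact W.hitProb_le_one r n s⟩⟩
  choose h hh using hlim
  have h1 : ∀ s, h s ≤ 1 := fun s => le_of_tendsto' (hh s) fun n => W.hitProb_le_one r n s
  have hr : h r = 1 := tendsto_nhds_unique (hh r) (by
    simp only [hitProb_self]; exact tendsto_const_nhds)
  have hstep : ∀ s, s ≠ r → ∀ x, ∑ y, ∑ s', W.kernel x s (y, s') * h s' ≤ h s := by
    intro s hs x
    refine le_of_tendsto_of_tendsto' ?_ ((tendsto_add_atTop_iff_nat 1).2 (hh s))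
      (fun n => W.le_hitProb_succ r n hs x)
    exact tendsto_finsetSum _ fun y _ => tendsto_finsetSum _ fun s' _ => (hh s').const_mul _
  have : Nonempty S := ⟨s⟩
  obtain ⟨s₀, hs₀⟩ := Finite.exists_min h
  -- The states at which `h` is minimal form a set that no input can leave.
  have hmin : 1 ≤ h s₀ := by
    by_contra! hlt
    obtain ⟨T, p, hp, hpos⟩ := hW s₀ r
    have hclosed : ∀ i s, h s ≠ h s₀ → W.stateLaw p s₀ i s = 0 := by
      intro i
      induction i with
      | zero =>
        intro s hs
        rw [stateLaw, if_neg]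
        rintro rfl
        exact hs rfl
      | succ i ih =>
        intro s' hs'
        rw [stateLaw]
        refine Finset.sum_eq_zero fun s _ => Finset.sum_eq_zero fun x _ =>
          Finset.sum_eq_zero fun y _ => ?_
        by_cases hs : h s = h s₀
        · have hsr : s ≠ r := by rintro rfl; linarith
          have h2 : ∑ y, ∑ s', W.kernel x s (y, s') * (h s' - h s₀) ≤ 0 := by
            simp only [mul_sub, Finset.sum_sub_distrib]
            rw [W.kernel_avg_const]
            linarith [hstep s hsr x]
          have h3 : ∀ y s', 0 ≤ W.kernel x s (y, s') * (h s' - h s₀) := fun y s' =>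
            mul_nonneg (W.kernel_nonneg _ _ _) (sub_nonneg.2 (hs₀ s'))
          have h4 : W.kernel x s (y, s') * (h s' - h s₀) ≤ 0 :=
            (Finset.single_le_sum (f := fun s' => W.kernel x s (y, s') * (h s' - h s₀))
              (fun s' _ => h3 y s') (Finset.mem_univ s')).trans
              ((Finset.single_le_sum (f := fun y => ∑ s', W.kernel x s (y, s') * (h s' - h s₀))
                (fun y _ => Finset.sum_nonneg fun s' _ => h3 y s') (Finset.mem_univ y)).trans h2)
          have h5 := le_antisymm h4 (h3 y s')
          rw [mul_eq_zero, sub_eq_zero] at h5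
          rw [h5.resolve_right hs', mul_zero]
        · rw [ih s hs, zero_mul, zero_mul]
    rw [Finset.sum_eq_zero fun i _ => hclosed i r (by rw [hr]; exact hlt.ne')] at hpos
    exact lt_irrefl _ hpos
  rw [show (1 : ℝ) = h s from le_antisymm (hmin.trans (hs₀ s)) (h1 s)]
  exact hh s

/-! ### Exponential moments of block scores -/

theorem minCost_take_le [Nonempty X] (N K : ℕ) (s : S) (g : List Y → ℝ) :
    W.minCost (N + K) s (fun l => g (l.take N)) ≤ W.minCost N s g := by
  induction N generalizing s g with
  | zero => exact W.minCost_le_of_le _ s fun l => (by simp [minCost])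
  | succ N ih =>
    obtain ⟨x, hx⟩ := W.exists_minCost_succ_eq N s g
    rw [← hx, Nat.add_right_comm]
    exact (W.minCost_succ_le _ s _ x).trans (W.kernel_avg_le fun y s' => ih s' fun l => g (y :: l))

/-- The mean minimal cost of a slot of length `N + K` in which the channel is first steered to `r`. The
hypothesis `hκ` says that a block of length `N` may start at any time `k ≤ K` of the slot and is then
charged at most `κ`. -/
theorem sum_minCost_slot_le [Nonempty X] {A : Type*} [Fintype A] {p : A → ℝ}
    (hp : p ∈ stdSimplex ℝ A) (r : S) (N : ℕ) (κ : A → List Y → ℝ) {ρ : ℝ}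
    (hρ : ∑ a, p a * W.minCost N r (κ a) ≤ ρ) (K : ℕ) (c : A → List Y → ℝ)
    (hc : ∀ a l, c a l ≤ 1) (hκ : ∀ a, ∀ k ≤ K, ∀ l, c a l ≤ κ a ((l.drop k).take N)) (s : S) :
    ∑ a, p a * W.minCost (N + K) s (c a) ≤ 1 - W.hitProb r K s * (1 - ρ) := by
  have hstart : ∀ K (c : A → List Y → ℝ), (∀ a l, c a l ≤ κ a (l.take N)) →
      ∑ a, p a * W.minCost (N + K) r (c a) ≤ ρ := fun K c h =>
    (Finset.sum_le_sum fun a _ => mul_le_mul_of_nonneg_left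
      ((W.minCost_mono _ r (h a)).trans (W.minCost_take_le N K r (κ a))) (hp.1 a)).trans hρ
  induction K generalizing c s with
  | zero =>
    rcases eq_or_ne s r with rfl | hs
    · rw [hitProb_self]
      linarith [hstart 0 c fun a l => by simpa using hκ a 0 le_rfl l]
    · simp only [hitProb, if_neg hs, zero_mul, sub_zero]
      calc _ ≤ ∑ a, p a * 1 := Finset.sum_le_sum fun a _ =>
            mul_le_mul_of_nonneg_left (W.minCost_le_of_le _ s (hc a)) (hp.1 a)
        _ = 1 := by simp [hp.2]
  | succ K ih =>
    rcases eq_or_ne s r with rfl | hs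
    · rw [hitProb_self]
      linarith [hstart (K + 1) c fun a l => by simpa using hκ a 0 (Nat.zero_le _) l]
    · obtain ⟨x, hx⟩ := W.exists_hitProb_succ_eq r K hs
      calc _ ≤ ∑ a, p a * ∑ y, ∑ s', W.kernel x s (y, s') *
              W.minCost (N + K) s' (fun l => c a (y :: l)) :=
            Finset.sum_le_sum fun a _ => mul_le_mul_of_nonneg_left
              (W.minCost_succ_le _ s _ x) (hp.1 a)
        _ = ∑ y, ∑ s', W.kernel x s (y, s') *
              ∑ a, p a * W.minCost (N + K) s' (fun l => c a (y :: l)) := by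
            simp only [Finset.mul_sum]
            rw [Finset.sum_comm]
            refine Finset.sum_congr rfl fun y _ => ?_
            rw [Finset.sum_comm]
            exact Finset.sum_congr rfl fun s' _ => Finset.sum_congr rfl fun a _ => by ring
        _ ≤ ∑ y, ∑ s', W.kernel x s (y, s') * (1 - W.hitProb r K s' * (1 - ρ)) :=
            W.kernel_avg_le fun y s' => ih (fun a l => c a (y :: l)) (fun a l => hc a _)
              (fun a k hk l => by simpa using hκ a (k + 1) (by omega) (y :: l)) s'
        _ = _ := by
            simp only [mul_sub, Finset.sum_sub_distrib, ← mul_assoc]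
            rw [W.kernel_avg_const, ← hx]
            simp only [mul_one, Finset.sum_mul]

/-- If the mean minimal cost of a second block is at most `C` from every state, then multiplying the
cost of a first block by that of the second multiplies the mean minimal cost by at most `C`. -/
theorem sum_minCost_append_le [Nonempty X] {ι : Type*} [Fintype ι] {P : ι → ℝ}
    (hP : ∀ i, 0 ≤ P i) (m : ℕ) (g : ι → List Y → ℝ) {C : ℝ}
    (h : ∀ s, ∑ i, P i * W.minCost m s (g i) ≤ C) (L : ℕ) (s : S) (k : List Y → ℝ)
    (hk : ∀ l, 0 ≤ k l) :
    ∑ i, P i * W.minCost (L + m) s (fun l => k (l.take L) * g i (l.drop L)) ≤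
      W.minCost L s k * C := by
  induction L generalizing s k with
  | zero =>
    calc _ ≤ ∑ i, P i * (k [] * W.minCost m s (g i)) := by
          refine Finset.sum_le_sum fun i _ => mul_le_mul_of_nonneg_left ?_ (hP i)
          simpa using W.minCost_mul_le m s (k []) (g i)
      _ = k [] * ∑ i, P i * W.minCost m s (g i) := by
          rw [Finset.mul_sum]; exact Finset.sum_congr rfl fun i _ => by ring
      _ ≤ k [] * C := mul_le_mul_of_nonneg_left (h s) (hk [])
  | succ L ih =>
    obtain ⟨x, hx⟩ := W.exists_minCost_succ_eq L s k
    rw [← hx, Nat.add_right_comm]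
    calc _ ≤ ∑ i, P i * ∑ y, ∑ s', W.kernel x s (y, s') *
            W.minCost (L + m) s' (fun l => k (y :: l.take L) * g i (l.drop L)) :=
          Finset.sum_le_sum fun i _ => mul_le_mul_of_nonneg_left
            (W.minCost_succ_le _ s _ x) (hP i)
      _ = ∑ y, ∑ s', W.kernel x s (y, s') *
            ∑ i, P i * W.minCost (L + m) s' (fun l => k (y :: l.take L) * g i (l.drop L)) := by
          simp only [Finset.mul_sum]
          rw [Finset.sum_comm]
          refine Finset.sum_congr rfl fun y _ => ?_
          rw [Finset.sum_comm]
          exact Finset.sum_congr rfl fun s' _ => Finset.sum_congr rfl fun a _ => by ring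
      _ ≤ ∑ y, ∑ s', W.kernel x s (y, s') * (W.minCost L s' (fun l => k (y :: l)) * C) :=
          W.kernel_avg_le fun y s' => ih s' (fun l => k (y :: l)) fun l => hk _
      _ = _ := by simp only [Finset.sum_mul, mul_assoc]

theorem sum_minCost_scoreProd_le [Nonempty X] {A : Type*} [Fintype A] {p : A → ℝ}
    (hp : ∀ a, 0 ≤ p a) (L : ℕ) {z : A → List Y → ℝ} (hz : ∀ a l, 0 < z a l) (ν : ℝ) {ρ : ℝ}
    (hρ0 : 0 ≤ ρ) (hρ : ∀ s, ∑ a, p a * W.minCost L s (fun l => z a l ^ ν) ≤ ρ) (B n : ℕ)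
    (hn : L * B ≤ n) (s : S) :
    ∑ b : Fin B → A, (∏ j, p (b j)) *
      W.minCost n s (fun l => scoreProd L z (List.ofFn b) l ^ ν) ≤ ρ ^ B := by
  induction B generalizing n s with
  | zero =>
    simp only [Fintype.sum_unique, Finset.univ_eq_empty, Finset.prod_empty, one_mul, pow_zero]
    exact W.minCost_le_of_le n s fun l => by simp [scoreProd]
  | succ B ih =>
    obtain ⟨m, rfl⟩ : ∃ m, n = L + m := ⟨n - L, by rw [mul_add] at hn; omega⟩
    have hm : L * B ≤ m := by rw [mul_add] at hn; omega
    rw [sum_fin_cons]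
    calc _ = ∑ a, p a * ∑ b : Fin B → A, (∏ j, p (b j)) * W.minCost (L + m) s
            (fun l => z a (l.take L) ^ ν * scoreProd L z (List.ofFn b) (l.drop L) ^ ν) := by
          refine Finset.sum_congr rfl fun a _ => ?_
          rw [Finset.mul_sum]
          refine Finset.sum_congr rfl fun b _ => ?_
          rw [Fin.prod_univ_succ, List.ofFn_cons]
          simp only [Fin.cons_zero, Fin.cons_succ, scoreProd]
          simp only [Real.mul_rpow (hz _ _).le (scoreProd_pos L hz _ _).le, mul_assoc]
      _ ≤ ∑ a, p a * (W.minCost L s (fun l => z a l ^ ν) * ρ ^ B) := by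
          refine Finset.sum_le_sum fun a _ => mul_le_mul_of_nonneg_left ?_ (hp a)
          exact W.sum_minCost_append_le
            (fun b : Fin B → A => Finset.prod_nonneg fun j _ => hp (b j)) m
            (fun b l => scoreProd L z (List.ofFn b) l ^ ν) (fun s => ih m hm s) L s
            (fun l => z a l ^ ν) fun l => Real.rpow_nonneg (hz a l).le _
      _ ≤ ρ ^ (B + 1) := by
          simp only [← mul_assoc]
          rw [← Finset.sum_mul, pow_succ']
          exact mul_le_mul_of_nonneg_right (hρ s) (by positivity)

end Steering

/-! ### Codes that follow code trees -/

section Coding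

variable {X Y S U : Type*} [Fintype X] [Fintype Y] [Fintype S]
variable (W : FSC X Y S) (f : U → S → X)

/-- The code whose encoder follows the code tree `t m` when `m` is the message. -/
def treeCode {n M : ℕ} (t : Fin M → List Y → U) (dec : (Fin n → Y) → Fin M) : Code X Y S n M where
  enc m i s y := f (t m (List.ofFn y)) (s (Fin.last i))
  dec := dec

theorem errorProb_treeCode {n M : ℕ} (t : Fin M → List Y → U) (dec : (Fin n → Y) → Fin M) :
    W.errorProb (treeCode f t dec) = 1 / (M : ℝ) * ∑ m, ∑ y,
      if dec y = m then 0 else W.avgTreeLaw f (t m) (List.ofFn y) := by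
  rw [errorProb, Finset.mul_sum]
  refine Finset.sum_congr rfl fun m _ => ?_
  rw [Finset.sum_comm, Finset.mul_sum]
  refine Finset.sum_congr rfl fun y _ => ?_
  change (∑ s, if dec y = m then 0 else W.codeLaw (treeCode f t dec) m s y) = _
  split_ifs with h
  · simp
  · rw [avgTreeLaw_ofFn, avgLaw, ← sum_states_eq_outLaw, Finset.mul_sum]
    refine Finset.sum_congr rfl fun s _ => ?_
    rw [codeLaw, mul_assoc]
    rfl

/-- Every code can be replaced by one that follows code trees. -/
theorem exists_trees_errorProb_le [Nonempty X] (hf : Function.Surjective f) {n M : ℕ}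
    (c : Code X Y S n M) : ∃ t : Fin M → List Y → U, W.errorProb (treeCode f t c.dec) ≤
      W.errorProb c := by
  classical
  have hg : ∀ m, ∃ g : List Y → ℝ, ∀ y : Fin n → Y, g (List.ofFn y) =
      if c.dec y = m then 0 else 1 := fun m => by
    refine ⟨fun l => if hl : l.length = n then
      (if c.dec (fun i => l.get (i.cast hl.symm)) = m then 0 else 1) else 0, fun y => ?_⟩
    simp
  choose g hg using hg
  choose t ht using fun m => W.exists_treeLaw_eq_minCost f hf n (g m)
  refine ⟨t, ?_⟩
  rw [errorProb_treeCode, Finset.mul_sum, errorProb]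
  refine Finset.sum_le_sum fun m _ => ?_
  calc _ = 1 / (M : ℝ) * ∑ s, W.init s * W.minCost n s (g m) := by
        congr 1
        simp only [← ht, hg, Finset.mul_sum]
        rw [Finset.sum_comm]
        refine Finset.sum_congr rfl fun y _ => ?_
        split_ifs
        · simp
        · simp [avgTreeLaw]
    _ ≤ 1 / (M : ℝ) * ∑ s₀, W.init s₀ * _ := by
        refine mul_le_mul_of_nonneg_left (Finset.sum_le_sum fun s₀ _ => mul_le_mul_of_nonneg_left
          (W.minCost_le_of_encoder (c.enc m) s₀ (g m)) (W.init_mem.1 s₀)) (by positivity)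
    _ = _ := by
        rw [sum_fin_cons, Finset.mul_sum]
        refine Finset.sum_congr rfl fun s₀ _ => ?_
        simp only [Finset.mul_sum, hg]
        refine Finset.sum_congr rfl fun s _ => Finset.sum_congr rfl fun y _ => ?_
        rw [codeLaw]
        split_ifs
        · simp
        · simp only [Fin.cons_zero, mul_one, mul_assoc]

theorem codeLaw_nonneg {n M : ℕ} (c : Code X Y S n M) (m : Fin M) (s : Fin (n + 1) → S)
    (y : Fin n → Y) : 0 ≤ W.codeLaw c m s y :=
  mul_nonneg (mul_nonneg (by positivity) (W.init_mem.1 _))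
    (Finset.prod_nonneg fun i _ => W.kernel_nonneg _ _ _)

theorem errorProb_nonneg {n M : ℕ} (c : Code X Y S n M) : 0 ≤ W.errorProb c :=
  Finset.sum_nonneg fun m _ => Finset.sum_nonneg fun s _ => Finset.sum_nonneg fun y _ => by
    split_ifs
    · exact le_rfl
    · exact W.codeLaw_nonneg c m s y

theorem nonempty_state (W : FSC X Y S) : Nonempty S := by
  by_contra h
  rw [not_nonempty_iff] at h
  have := W.init_mem.2
  simp at this

/-- Codewords are sequences of `B` independent letters with law `p`, and a codeword passes the test if
the product of its block scores is at least `1`. By `hc` and Markov's inequality a false codeword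
passes with probability at most `c ^ B`; by `hρ`, Chernoff's bound, the true one fails with
probability at most `ρ ^ B`. -/
theorem exists_code_of_score [Nonempty X] (hf : Function.Surjective f) {A : Type*} [Fintype A]
    {p : A → ℝ} (hp : p ∈ stdSimplex ℝ A) (L : ℕ) {z : A → List Y → ℝ} (hz : ∀ a l, 0 < z a l)
    {c : ℝ} (hc : ∀ l, ∑ a, p a * z a l ≤ c) {l₀ : ℝ} (hl₀ : 0 < l₀) {ρ : ℝ} (hρ0 : 0 ≤ ρ)
    (hρ : ∀ s, ∑ a, p a * W.minCost L s (fun l => z a l ^ (-l₀)) ≤ ρ) (n B : ℕ) (hn : L * B ≤ n)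
    {M : ℕ} (hM : 0 < M) :
    ∃ C : Code X Y S n M, W.errorProb C ≤ ρ ^ B + M * c ^ B := by
  classical
  -- The encoder of a codeword minimizes the exponential moment of its score.
  choose t ht using fun b : Fin B → A =>
    W.exists_treeLaw_eq_minCost f hf n (fun l => scoreProd L z (List.ofFn b) l ^ (-l₀))
  refine (exists_codebook (fun b : Fin B → A => ∏ j, p (b j))
    (pi_prod_mem_stdSimplex (fun _ => p) fun _ => hp)
    (fun b (y : Fin n → Y) => W.avgTreeLaw f (t b) (List.ofFn y))
    (fun b => W.avgTreeLaw_mem_stdSimplex f n (t b))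
    (fun b y => 1 ≤ scoreProd L z (List.ofFn b) (List.ofFn y)) (ρ ^ B) (c ^ B) ?_ ?_
    hM).elim fun b ⟨dec, h⟩ =>
      ⟨treeCode f (fun m => t (b m)) dec, by rw [errorProb_treeCode]; exact h⟩
  · calc _ ≤ ∑ b : Fin B → A, (∏ j, p (b j)) * ∑ s, W.init s *
            W.minCost n s (fun l => scoreProd L z (List.ofFn b) l ^ (-l₀)) := by
          refine Finset.sum_le_sum fun b _ => mul_le_mul_of_nonneg_left ?_
            (Finset.prod_nonneg fun j _ => hp.1 _)
          simp only [← ht b, avgTreeLaw, Finset.sum_mul, Finset.mul_sum]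
          rw [Finset.sum_comm]
          refine Finset.sum_le_sum fun s _ => Finset.sum_le_sum fun y _ => ?_
          rw [mul_assoc]
          refine mul_le_mul_of_nonneg_left (mul_le_mul_of_nonneg_left ?_
            (W.treeLaw_nonneg f s _ _)) (W.init_mem.1 s)
          have hpos := scoreProd_pos L hz (List.ofFn b) (List.ofFn y)
          split_ifs with h1
          · exact Real.rpow_nonneg hpos.le _
          · exact Real.one_le_rpow_of_pos_of_le_one_of_nonpos hpos (not_le.1 h1).le (by linarith)
      _ = ∑ s, W.init s * ∑ b : Fin B → A, (∏ j, p (b j)) *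
            W.minCost n s (fun l => scoreProd L z (List.ofFn b) l ^ (-l₀)) := by
          simp only [Finset.mul_sum]
          rw [Finset.sum_comm]
          exact Finset.sum_congr rfl fun s' _ => Finset.sum_congr rfl fun a _ => by ring
      _ ≤ ∑ s, W.init s * ρ ^ B := Finset.sum_le_sum fun s _ => mul_le_mul_of_nonneg_left
            (W.sum_minCost_scoreProd_le hp.1 L hz (-l₀) hρ0 hρ B n hn s) (W.init_mem.1 s)
      _ = ρ ^ B := by rw [← Finset.sum_mul, W.init_mem.2, one_mul]
  · intro y
    refine le_trans (Finset.sum_le_sum fun b _ => mul_le_mul_of_nonneg_left ?_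
      (Finset.prod_nonneg fun j _ => hp.1 _)) (sum_scoreProd_le L hz hp.1 hc B (List.ofFn y))
    split_ifs with h1
    · exact h1
    · exact (scoreProd_pos L hz _ _).le

theorem achievable_of_score [Nonempty X] (hf : Function.Surjective f) {A : Type*} [Fintype A]
    {p : A → ℝ} (hp : p ∈ stdSimplex ℝ A) {L : ℕ} (hL : 0 < L) {z : A → List Y → ℝ}
    (hz : ∀ a l, 0 < z a l) {R : ℝ} (hR : 0 ≤ R) {c : ℝ} (hc : ∀ l, ∑ a, p a * z a l ≤ c)
    (hcR : (2 : ℝ) ^ (L * R) * c < 1) {l₀ : ℝ} (hl₀ : 0 < l₀) {ρ : ℝ} (hρ1 : ρ < 1)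
    (hρ : ∀ s, ∑ a, p a * W.minCost L s (fun l => z a l ^ (-l₀)) ≤ ρ) :
    W.Achievable R := by
  have hρ0 : 0 ≤ ρ := by
    obtain ⟨s⟩ := W.nonempty_state
    exact (Finset.sum_nonneg fun a _ => mul_nonneg (hp.1 a)
      (W.minCost_nonneg L s fun l => Real.rpow_nonneg (hz a l).le _)).trans (hρ s)
  have hc0 : 0 ≤ c :=
    (Finset.sum_nonneg fun a _ => mul_nonneg (hp.1 a) (hz a []).le).trans (hc [])
  have hM : ∀ n : ℕ, 0 < ⌈(2 : ℝ) ^ ((n : ℝ) * R)⌉₊ := fun n => Nat.ceil_pos.2 (by positivity)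
  choose C hC using fun n : ℕ => W.exists_code_of_score f hf hp L hz hc hl₀ hρ0 hρ n (n / L)
    (Nat.mul_div_le n L) (hM n)
  refine ⟨C, ?_⟩
  have hbound : ∀ n, W.errorProb (C n) ≤ ρ ^ (n / L) +
      2 * (2 : ℝ) ^ (L * R) * ((2 : ℝ) ^ (L * R) * c) ^ (n / L) := by
    intro n
    refine (hC n).trans (add_le_add le_rfl ?_)
    have h1 : (⌈(2 : ℝ) ^ ((n : ℝ) * R)⌉₊ : ℝ) ≤ 2 * (2 : ℝ) ^ ((n : ℝ) * R) := by
      have := (Nat.ceil_lt_add_one (show (0 : ℝ) ≤ (2 : ℝ) ^ ((n : ℝ) * R) by positivity)).le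
      have h2 : (1 : ℝ) ≤ (2 : ℝ) ^ ((n : ℝ) * R) :=
        Real.one_le_rpow (by norm_num) (by positivity)
      linarith
    have h2 : (2 : ℝ) ^ ((n : ℝ) * R) ≤ (2 : ℝ) ^ (L * R) * ((2 : ℝ) ^ (L * R)) ^ (n / L) := by
      rw [← Real.rpow_mul_natCast (by norm_num), ← Real.rpow_add (by norm_num)]
      refine Real.rpow_le_rpow_of_exponent_le (by norm_num) ?_
      have h3 : (n : ℝ) ≤ L + L * (n / L : ℕ) := by
        have : n ≤ L + L * (n / L) := by
          have := Nat.div_add_mod n L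
          have := Nat.mod_lt n hL
          omega
        exact_mod_cast this
      nlinarith
    calc _ ≤ 2 * ((2 : ℝ) ^ (L * R) * ((2 : ℝ) ^ (L * R)) ^ (n / L)) * c ^ (n / L) := by
          refine mul_le_mul_of_nonneg_right (h1.trans ?_) (by positivity)
          linarith
      _ = _ := by rw [mul_pow]; ring
  refine squeeze_zero (fun n => W.errorProb_nonneg _) hbound ?_
  have hdiv : Tendsto (fun n : ℕ => n / L) atTop atTop := Nat.tendsto_div_const_atTop hL.ne'
  have t1 := (tendsto_pow_atTop_nhds_zero_of_lt_one hρ0 hρ1).comp hdiv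
  have t2 := ((tendsto_pow_atTop_nhds_zero_of_lt_one (by positivity) hcR).comp hdiv).const_mul
    (2 * (2 : ℝ) ^ (L * R))
  simpa using t1.add t2

end Coding

end FSC

/-! ### Achievability -/

namespace FSC

variable {X Y S U : Type*} [Fintype X] [Fintype Y] [Fintype S]
variable (W : FSC X Y S) (f : U → S → X)

/-- Mutual information is convex in the channel, so for some initial state the information between a
random code tree and the outputs is at least as large as for the random initial state. -/
theorem exists_state_le_info {A : Type*} [Fintype A] {p : A → ℝ} (hp : p ∈ stdSimplex ℝ A)
    (t : A → List Y → U) (N : ℕ) : ∃ s,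
      ∑ y : Fin N → Y, ∑ a, p a * (W.avgTreeLaw f (t a) (List.ofFn y) *
        Real.logb 2 (W.avgTreeLaw f (t a) (List.ofFn y) /
          ∑ b, p b * W.avgTreeLaw f (t b) (List.ofFn y))) ≤
      ∑ y : Fin N → Y, ∑ a, p a * (W.treeLaw f s (t a) (List.ofFn y) *
        Real.logb 2 (W.treeLaw f s (t a) (List.ofFn y) /
          ∑ b, p b * W.treeLaw f s (t b) (List.ofFn y))) := by
  set Q : (Fin N → Y) → ℝ := fun y => ∑ b, p b * W.avgTreeLaw f (t b) (List.ofFn y) with hQ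
  set P : S → (Fin N → Y) → ℝ := fun s y => ∑ b, p b * W.treeLaw f s (t b) (List.ofFn y) with hP
  have hL0 : ∀ a (y : Fin N → Y), 0 ≤ W.avgTreeLaw f (t a) (List.ofFn y) :=
    fun a y => (W.avgTreeLaw_mem_stdSimplex f N (t a)).1 y
  have hQ0 : ∀ y, 0 ≤ Q y := fun y => Finset.sum_nonneg fun b _ => mul_nonneg (hp.1 b) (hL0 b y)
  have hP0 : ∀ s y, 0 ≤ P s y := fun s y => Finset.sum_nonneg fun b _ =>
    mul_nonneg (hp.1 b) (W.treeLaw_nonneg f s _ _)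
  have hPQ : ∀ y, ∑ s, W.init s * P s y = Q y := by
    intro y
    simp only [hQ, hP, avgTreeLaw, Finset.mul_sum]
    rw [Finset.sum_comm]
    exact Finset.sum_congr rfl fun s' _ => Finset.sum_congr rfl fun a _ => by ring
  have hle := sum_mul_logb_le
    (fun i : S × (Fin N → Y) × A => W.init i.1 * (p i.2.2 *
      W.treeLaw f i.1 (t i.2.2) (List.ofFn i.2.1)))
    (fun i => W.init i.1 * (p i.2.2 * P i.1 i.2.1))
    (fun i => W.avgTreeLaw f (t i.2.2) (List.ofFn i.2.1) / Q i.2.1)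
    (fun i => mul_nonneg (W.init_mem.1 _) (mul_nonneg (hp.1 _) (W.treeLaw_nonneg f _ _ _)))
    (fun i => mul_nonneg (W.init_mem.1 _) (mul_nonneg (hp.1 _) (hP0 _ _)))
    (fun i => div_nonneg (hL0 _ _) (hQ0 _))
    (by
      rintro ⟨s, y, a⟩ h
      have h1 := left_ne_zero_of_mul h
      have h2 := left_ne_zero_of_mul (right_ne_zero_of_mul h)
      have h3 := right_ne_zero_of_mul (right_ne_zero_of_mul h)
      have h1' : 0 < W.init s := lt_of_le_of_ne (W.init_mem.1 s) h1.symm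
      have h2' : 0 < p a := lt_of_le_of_ne (hp.1 a) h2.symm
      have h3' : 0 < W.treeLaw f s (t a) (List.ofFn y) :=
        lt_of_le_of_ne (W.treeLaw_nonneg f _ _ _) (Ne.symm h3)
      have h4 : 0 < P s y := lt_of_lt_of_le (mul_pos h2' h3') (Finset.single_le_sum
        (f := fun b => p b * W.treeLaw f s (t b) (List.ofFn y))
        (fun b _ => mul_nonneg (hp.1 b) (W.treeLaw_nonneg f s _ _)) (Finset.mem_univ a))
      have h5 : 0 < W.avgTreeLaw f (t a) (List.ofFn y) := lt_of_lt_of_le (mul_pos h1' h3')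
        (Finset.single_le_sum (f := fun s => W.init s * W.treeLaw f s (t a) (List.ofFn y))
        (fun b _ => mul_nonneg (W.init_mem.1 b) (W.treeLaw_nonneg f _ _ _)) (Finset.mem_univ s))
      have h6 : 0 < Q y := lt_of_lt_of_le (mul_pos h2' h5) (Finset.single_le_sum
        (f := fun b => p b * W.avgTreeLaw f (t b) (List.ofFn y))
        (fun b _ => mul_nonneg (hp.1 b) (hL0 b y)) (Finset.mem_univ a))
      exact ⟨(mul_pos h1' (mul_pos h2' h4)).ne', (div_pos h5 h6).ne'⟩)
    (by
      have h1 : ∑ i : S × (Fin N → Y) × A, W.init i.1 * (p i.2.2 *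
          W.treeLaw f i.1 (t i.2.2) (List.ofFn i.2.1)) = 1 := by
        simp only [Fintype.sum_prod_type, ← Finset.mul_sum]
        have : ∀ s, ∑ y : Fin N → Y, ∑ a, p a * W.treeLaw f s (t a) (List.ofFn y) = 1 := by
          intro s
          rw [Finset.sum_comm]
          simp only [← Finset.mul_sum, sum_treeLaw, mul_one, hp.2]
        simp only [this, mul_one, W.init_mem.2]
      have h2 : ∑ i : S × (Fin N → Y) × A, W.init i.1 * (p i.2.2 * P i.1 i.2.1) *
          (W.avgTreeLaw f (t i.2.2) (List.ofFn i.2.1) / Q i.2.1) = ∑ y, Q y * (Q y / Q y) := by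
        simp only [Fintype.sum_prod_type]
        rw [Finset.sum_comm]
        refine Finset.sum_congr rfl fun y _ => ?_
        rw [← hPQ y, Finset.sum_mul, hPQ y]
        refine Finset.sum_congr rfl fun s _ => ?_
        conv_rhs => rw [hQ]
        dsimp only
        rw [Finset.sum_div, Finset.mul_sum]
        exact Finset.sum_congr rfl fun a _ => by ring
      rw [h1, h2]
      calc _ ≤ ∑ y, Q y := Finset.sum_le_sum fun y _ =>
            mul_le_of_le_one_right (hQ0 y) (div_self_le_one _)
        _ = 1 := by
            simp only [hQ]
            rw [Finset.sum_comm]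
            simp only [← Finset.mul_sum, (W.avgTreeLaw_mem_stdSimplex f N _).2, mul_one, hp.2])
  by_contra! hcon
  obtain ⟨s₁, hs₁⟩ : ∃ s, 0 < W.init s := by
    by_contra! h
    have := Finset.sum_nonpos fun s (_ : s ∈ (Finset.univ : Finset S)) => h s
    linarith [W.init_mem.2]
  have hlt := Finset.sum_lt_sum (s := Finset.univ)
    (fun s _ => mul_le_mul_of_nonneg_left (hcon s).le (W.init_mem.1 s))
    ⟨s₁, Finset.mem_univ _, mul_lt_mul_of_pos_left (hcon s₁) hs₁⟩
  rw [← Finset.sum_mul, W.init_mem.2, one_mul] at hlt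
  refine absurd hlt (not_lt.2 ?_)
  refine le_trans (le_of_eq ?_) (hle.trans_eq ?_)
  · simp only [Fintype.sum_prod_type]
    conv_rhs => rw [Finset.sum_comm]
    refine Finset.sum_congr rfl fun y _ => ?_
    conv_rhs => rw [Finset.sum_comm]
    refine Finset.sum_congr rfl fun a _ => ?_
    rw [← Finset.sum_mul]
    have : ∑ s, W.init s * (p a * W.treeLaw f s (t a) (List.ofFn y)) =
        p a * W.avgTreeLaw f (t a) (List.ofFn y) := by
      rw [avgTreeLaw, Finset.mul_sum]
      exact Finset.sum_congr rfl fun a _ => by ring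
    rw [this, mul_assoc]
  · simp only [Fintype.sum_prod_type, Finset.mul_sum]
    refine Finset.sum_congr rfl fun s _ => Finset.sum_congr rfl fun y _ =>
      Finset.sum_congr rfl fun a _ => ?_
    rcases eq_or_ne (W.init s) 0 with h1 | h1
    · simp [h1]
    rcases eq_or_ne (p a) 0 with h2 | h2
    · simp [h2]
    rw [mul_div_mul_left _ _ h1, mul_div_mul_left _ _ h2]
    ring

variable [Fintype U]

/-- If the steering succeeds within `K` steps with probability at least `h`, then slots of length
`N + K` convey `h * I(U^N → Y^N)` bits, up to the `log₂ (K + 2)` bits lost on the starting times. -/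
theorem achievable_of_info [Nonempty X] [Nonempty U] (hf : Function.Surjective f) {R : ℝ}
    (hR : 0 ≤ R) {N K : ℕ} (hN : 0 < N) {h : ℝ} (h0 : 0 < h)
    (hK : ∀ r s, h ≤ W.hitProb r K s)
    (hI : (N + K : ℕ) * R + Real.logb 2 (K + 2) < h * W.maxDirectedInfo f N) :
    W.Achievable R := by
  obtain ⟨q, hq⟩ := (W.isGreatest_maxDirectedInfo f N).1
  obtain ⟨k, p, t, hp, ht⟩ := q.exists_isTreeMixture
  dsimp only at hq
  rw [W.auxDirectedInfo_eq_of_isTreeMixture f ht] at hq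
  obtain ⟨r, hr⟩ := W.exists_state_le_info f hp t N
  rw [hq] at hr
  -- likelihood ratio of the code tree `a` and the output list `l`, for a block started in state `r`
  let ζ : Fin k → List Y → ℝ := fun a l =>
    W.treeLaw f r (t a) l / ∑ b, p b * W.treeLaw f r (t b) l
  have hP0 : ∀ l, 0 ≤ ∑ b, p b * W.treeLaw f r (t b) l := fun l =>
    Finset.sum_nonneg fun b _ => mul_nonneg (hp.1 b) (W.treeLaw_nonneg f r _ _)
  have hζ0 : ∀ a l, 0 ≤ ζ a l := fun a l => div_nonneg (W.treeLaw_nonneg f r _ _) (hP0 l)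
  have hζ1 : ∀ l, ∑ a, p a * ζ a l ≤ 1 := fun l => by
    simp only [ζ, mul_div_assoc', ← Finset.sum_div]
    exact div_self_le_one _
  -- Modified where it vanishes, an event of probability zero, so that its powers are meaningful.
  let ζ' : Fin k → List Y → ℝ := fun a l => if 0 < ζ a l then ζ a l else 1
  have hζ' : ∀ a l, 0 < ζ' a l := fun a l => by
    simp only [ζ']; split_ifs with h1
    · exact h1
    · exact one_pos
  have hlog : ∀ a l, Real.logb 2 (ζ' a l) = Real.logb 2 (ζ a l) := fun a l => by
    simp only [ζ']; split_ifs with h1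
    · rfl
    · rw [le_antisymm (not_lt.1 h1) (hζ0 a l)]; simp
  have hlogK : 0 ≤ Real.logb 2 (K + 2) :=
    Real.logb_nonneg (by norm_num) (by linarith [K.cast_nonneg (α := ℝ)])
  obtain ⟨θ, hθ1, hθ2⟩ := exists_between hI
  have hθ0 : 0 ≤ θ := le_trans (by positivity) hθ1.le
  obtain ⟨l₀, hl₀, hρ1, hρ2⟩ := exists_pos_mul_sum_rpow_lt_one
    (fun i : (Fin N → Y) × Fin k => p i.2 * W.treeLaw f r (t i.2) (List.ofFn i.1))
    (fun i => ζ' i.2 (List.ofFn i.1))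
    ⟨fun i => mul_nonneg (hp.1 _) (W.treeLaw_nonneg f r _ _), by
      rw [Fintype.sum_prod_type, Finset.sum_comm]
      simp only [← Finset.mul_sum, sum_treeLaw, mul_one, hp.2]⟩
    (fun i => hζ' _ _) h0 hθ0 (hθ2.trans_le (by
      refine mul_le_mul_of_nonneg_left (hr.trans_eq ?_) h0.le
      rw [Fintype.sum_prod_type]
      simp only [hlog, mul_assoc]
      rfl))
  set ρ := ∑ i : (Fin N → Y) × Fin k, p i.2 * W.treeLaw f r (t i.2) (List.ofFn i.1) *
    ζ' i.2 (List.ofFn i.1) ^ (-l₀) with hρ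
  -- The starting time of the block is unknown, so the ratios of all possible blocks are added; the
  -- summand `1` takes care of the slots in which steering fails.
  let z : Fin k → List Y → ℝ := fun a l =>
    1 + ∑ j ∈ Finset.range (K + 1), ζ a ((l.drop j).take N)
  have hz1 : ∀ a l, 1 ≤ z a l := fun a l =>
    le_add_of_nonneg_right (Finset.sum_nonneg fun j _ => hζ0 _ _)
  have hzζ : ∀ a, ∀ j ≤ K, ∀ l, ζ a ((l.drop j).take N) ≤ z a l := fun a j hj l =>
    (Finset.single_le_sum (f := fun j => ζ a ((l.drop j).take N)) (fun j _ => hζ0 _ _)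
      (Finset.mem_range.2 (Nat.lt_succ_of_le hj))).trans (by simp [z])
  have hκ : ∑ a, p a * W.minCost N r (fun l => ζ' a l ^ (-l₀)) ≤ ρ := by
    rw [hρ, Fintype.sum_prod_type, Finset.sum_comm]
    refine Finset.sum_le_sum fun a _ => ?_
    simp only [mul_assoc, ← Finset.mul_sum]
    exact mul_le_mul_of_nonneg_left (W.minCost_le_treeLaw f N r (t a) _) (hp.1 a)
  have hslot : ∀ s, ∑ a, p a * W.minCost (N + K) s (fun l => z a l ^ (-l₀)) ≤
      1 - h * (1 - ρ) := by
    intro s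
    refine (W.sum_minCost_slot_le hp r N _ hκ K (fun a l => z a l ^ (-l₀)) (fun a l => ?_)
      (fun a j hj l => ?_) s).trans ?_
    · exact Real.rpow_le_one_of_one_le_of_nonpos (hz1 a l) (by linarith)
    · simp only [ζ']
      split_ifs with h1
      · exact Real.rpow_le_rpow_of_nonpos h1 (hzζ a j hj l) (by linarith)
      · rw [Real.one_rpow]
        exact Real.rpow_le_one_of_one_le_of_nonpos (hz1 a l) (by linarith)
    · have := mul_le_mul_of_nonneg_right (hK r s) (sub_nonneg.2 hρ1)
      linarith
  have hΘ : (0 : ℝ) < 2 ^ θ := by positivity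
  refine W.achievable_of_score f hf hp (L := N + K) (by omega) (z := fun a l => z a l / 2 ^ θ)
    (fun a l => div_pos (zero_lt_one.trans_le (hz1 a l)) hΘ) hR (c := (K + 2) / 2 ^ θ)
    (fun l => ?_) ?_ hl₀ hρ2 (fun s => ?_)
  · simp only [mul_div_assoc', ← Finset.sum_div]
    refine div_le_div_of_nonneg_right ?_ hΘ.le
    simp only [z, mul_add, Finset.sum_add_distrib, mul_one, hp.2, Finset.mul_sum]
    rw [Finset.sum_comm]
    calc _ ≤ 1 + ∑ j ∈ Finset.range (K + 1), (1 : ℝ) :=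
          add_le_add le_rfl (Finset.sum_le_sum fun j _ => hζ1 _)
      _ = K + 2 := by simp; ring
  · rw [mul_div_assoc', div_lt_one hΘ]
    calc _ = (2 : ℝ) ^ ((N + K : ℕ) * R + Real.logb 2 (K + 2)) := by
          rw [Real.rpow_add (by norm_num), Real.rpow_logb (by norm_num) (by norm_num) (by positivity)]
      _ < 2 ^ θ := Real.rpow_lt_rpow_of_exponent_lt (by norm_num) hθ1
  · calc _ ≤ ∑ a, p a * (((2 : ℝ) ^ θ) ^ l₀ * W.minCost (N + K) s (fun l => z a l ^ (-l₀))) := by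
          refine Finset.sum_le_sum fun a _ => mul_le_mul_of_nonneg_left ?_ (hp.1 a)
          refine le_trans (le_of_eq ?_) (W.minCost_mul_le (N + K) s _ _)
          congr 1
          funext l
          rw [Real.div_rpow (zero_le_one.trans (hz1 a l)) hΘ.le, Real.rpow_neg hΘ.le, div_inv_eq_mul,
            mul_comm]
      _ = ((2 : ℝ) ^ θ) ^ l₀ * ∑ a, p a * W.minCost (N + K) s (fun l => z a l ^ (-l₀)) := by
          rw [Finset.mul_sum]
          exact Finset.sum_congr rfl fun a _ => by ring
      _ ≤ _ := mul_le_mul_of_nonneg_left (hslot s) (by positivity)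

theorem achievable_of_frequently [Nonempty X] [Nonempty U] (hW : W.StronglyConnected)
    (hf : Function.Surjective f) {R ε : ℝ} (hR : 0 ≤ R) (hε : 0 < ε)
    (h : ∃ᶠ N : ℕ in atTop, R + ε ≤ 1 / (N : ℝ) * W.maxDirectedInfo f N) : W.Achievable R := by
  -- With this failure probability, half of the margin `ε` is left: `(1 - η) (R + ε) = R + ε / 2`.
  set η := ε / (2 * (R + ε)) with hη
  have hη0 : 0 < η := by positivity
  have hη1 : η < 1 := by rw [hη, div_lt_one (by positivity)]; linarith
  obtain ⟨K, hK⟩ : ∃ K, ∀ r s, 1 - η ≤ W.hitProb r K s := by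
    have : ∀ᶠ K in atTop, ∀ r s, 1 - η ≤ W.hitProb r K s :=
      eventually_all.2 fun r => eventually_all.2 fun s =>
        (W.tendsto_hitProb hW r s).eventually_const_le (by linarith)
    exact this.exists
  have hlarge : ∀ᶠ N : ℕ in atTop, K * R + Real.logb 2 (K + 2) < ε / 2 * (N : ℝ) :=
    (tendsto_natCast_atTop_atTop.const_mul_atTop (by positivity)).eventually_gt_atTop _
  obtain ⟨N, hN1, hN2, hN3⟩ := (h.and_eventually (hlarge.and (eventually_gt_atTop 0))).exists
  have hN0 : (0 : ℝ) < N := by exact_mod_cast hN3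
  refine W.achievable_of_info f hf hR hN3 (h := 1 - η) (by linarith) hK ?_
  rw [one_div, ← div_eq_inv_mul, le_div_iff₀ hN0] at hN1
  calc ((N + K : ℕ) : ℝ) * R + Real.logb 2 (K + 2) < N * R + ε / 2 * N := by
        push_cast; linarith
    _ = (1 - η) * ((R + ε) * N) := by
        rw [hη]; field_simp; ring
    _ ≤ _ := mul_le_mul_of_nonneg_left hN1 (by linarith)

/-! ### The converse -/

/-- **Fano's inequality** for codes used on the channel. -/
theorem log_card_le_maxDirectedInfo [Nonempty X] [Nonempty U] (hf : Function.Surjective f)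
    {n M : ℕ} (c : Code X Y S n M) (hM : 0 < M) :
    (1 - W.errorProb c) * Real.logb 2 M - 1 ≤ W.maxDirectedInfo f n := by
  classical
  obtain ⟨t, ht⟩ := W.exists_trees_errorProb_le f hf c
  have hM' : (0 : ℝ) < M := by exact_mod_cast hM
  have hp : (fun _ : Fin M => 1 / (M : ℝ)) ∈ stdSimplex ℝ (Fin M) :=
    ⟨fun _ => by positivity, by simp [hM'.ne']⟩
  obtain ⟨q, hq⟩ := CausalDist.exists_isTreeMixture_of_trees _ hp t n
  refine le_trans ?_ ((W.isGreatest_maxDirectedInfo f n).2 ⟨q, rfl⟩)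
  dsimp only
  rw [W.auxDirectedInfo_eq_of_isTreeMixture f hq]
  set e := W.errorProb (treeCode f t c.dec) with he
  set Q : (Fin n → Y) → ℝ := fun y => ∑ b, 1 / (M : ℝ) * W.avgTreeLaw f (t b) (List.ofFn y) with hQ
  have hL0 : ∀ a (y : Fin n → Y), 0 ≤ W.avgTreeLaw f (t a) (List.ofFn y) :=
    fun a y => (W.avgTreeLaw_mem_stdSimplex f n (t a)).1 y
  have hQ0 : ∀ y, 0 ≤ Q y := fun y => Finset.sum_nonneg fun b _ =>
    mul_nonneg (hp.1 b) (hL0 b y)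
  have hQ1 : ∑ y, Q y = 1 := by
    simp only [hQ]
    rw [Finset.sum_comm]
    simp only [← Finset.mul_sum, (W.avgTreeLaw_mem_stdSimplex f n _).2]
    simp [hM'.ne']
  have hsum1 : ∑ y : Fin n → Y, ∑ a, 1 / (M : ℝ) * W.avgTreeLaw f (t a) (List.ofFn y) = 1 := hQ1
  -- Compare with the density `M / 2` on correctly decoded pairs, and `1 / 2` on the others.
  have hle := sum_mul_logb_le
    (fun i : (Fin n → Y) × Fin M => 1 / (M : ℝ) * W.avgTreeLaw f (t i.2) (List.ofFn i.1))
    (fun i => 1 / (M : ℝ) * Q i.1) (fun i => if c.dec i.1 = i.2 then (M : ℝ) / 2 else 1 / 2)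
    (fun i => mul_nonneg (by positivity) (hL0 _ _)) (fun i => mul_nonneg (by positivity) (hQ0 _))
    (fun i => by split_ifs <;> positivity)
    (by
      rintro ⟨y, a⟩ h
      refine ⟨?_, by split_ifs <;> positivity⟩
      have h1 : 0 < 1 / (M : ℝ) * W.avgTreeLaw f (t a) (List.ofFn y) :=
        lt_of_le_of_ne (mul_nonneg (by positivity) (hL0 a y)) (Ne.symm h)
      have h2 : 0 < Q y := lt_of_lt_of_le h1 (Finset.single_le_sum
        (f := fun b => 1 / (M : ℝ) * W.avgTreeLaw f (t b) (List.ofFn y))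
        (fun b _ => mul_nonneg (by positivity) (hL0 b y)) (Finset.mem_univ a))
      positivity)
    (by
      rw [Fintype.sum_prod_type, Fintype.sum_prod_type, hsum1]
      calc _ ≤ ∑ y, ∑ a, (1 / (M : ℝ) * Q y * (if c.dec y = a then (M : ℝ) / 2 else 0) +
              1 / (M : ℝ) * Q y * (1 / 2)) := by
            refine Finset.sum_le_sum fun y _ => Finset.sum_le_sum fun a _ => ?_
            have : 0 ≤ 1 / (M : ℝ) * Q y := mul_nonneg (by positivity) (hQ0 y)
            split_ifs <;> linarith
        _ = ∑ y, Q y := by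
            refine Finset.sum_congr rfl fun y _ => ?_
            rw [Finset.sum_add_distrib, ← Finset.mul_sum, Finset.sum_ite_eq]
            simp only [Finset.mem_univ, if_true, Finset.sum_const, Finset.card_univ,
              Fintype.card_fin, nsmul_eq_mul]
            field_simp
            norm_num
        _ ≤ 1 := hQ1.le)
  rw [Fintype.sum_prod_type, Fintype.sum_prod_type] at hle
  have hL : ∑ y : Fin n → Y, ∑ a, 1 / (M : ℝ) * W.avgTreeLaw f (t a) (List.ofFn y) *
      Real.logb 2 (if c.dec y = a then (M : ℝ) / 2 else 1 / 2) = (1 - e) * Real.logb 2 M - 1 := by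
    have h1 : ∀ (y : Fin n → Y) (a : Fin M), 1 / (M : ℝ) * W.avgTreeLaw f (t a) (List.ofFn y) *
        Real.logb 2 (if c.dec y = a then (M : ℝ) / 2 else 1 / 2) =
        1 / (M : ℝ) * W.avgTreeLaw f (t a) (List.ofFn y) * (Real.logb 2 M - 1) -
          1 / (M : ℝ) * (if c.dec y = a then 0 else W.avgTreeLaw f (t a) (List.ofFn y)) *
            Real.logb 2 M := by
      intro y a
      split_ifs
      · rw [Real.logb_div hM'.ne' two_ne_zero, Real.logb_self_eq_one (by norm_num)]
        ring
      · rw [one_div (2 : ℝ), Real.logb_inv, Real.logb_self_eq_one (by norm_num)]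
        ring
    simp only [h1, Finset.sum_sub_distrib, ← Finset.sum_mul]
    rw [hsum1, he, errorProb_treeCode, Finset.sum_comm]
    simp only [← Finset.mul_sum]
    ring_nf
  have hlogM : 0 ≤ Real.logb 2 M := Real.logb_nonneg (by norm_num) (by exact_mod_cast hM)
  refine le_trans ?_ (hL.ge.trans (hle.trans_eq ?_))
  · have := mul_le_mul_of_nonneg_right ht hlogM
    linarith
  · refine Finset.sum_congr rfl fun y _ => Finset.sum_congr rfl fun a _ => ?_
    rw [mul_div_mul_left _ _ (by positivity : (1 / (M : ℝ)) ≠ 0), mul_assoc]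

theorem eventually_lt_of_achievable [Nonempty X] [Nonempty U] (hf : Function.Surjective f)
    {R r : ℝ} (hR : W.Achievable R) (hr : r < R) :
    ∀ᶠ N : ℕ in atTop, r < 1 / (N : ℝ) * W.maxDirectedInfo f N := by
  obtain ⟨c, hc⟩ := hR
  have hlim : Tendsto (fun n : ℕ => (1 - W.errorProb (c n)) * R - 1 / (n : ℝ)) atTop (𝓝 R) := by
    have := ((hc.const_sub 1).mul_const R).sub (tendsto_one_div_atTop_nhds_zero_nat (𝕜 := ℝ))
    simpa using this
  have he : ∀ᶠ n in atTop, W.errorProb (c n) < 1 := hc.eventually_lt_const one_pos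
  filter_upwards [hlim.eventually_const_lt hr, he, eventually_gt_atTop 0] with n h1 h2 h3
  refine h1.trans_le ?_
  have hn : (0 : ℝ) < n := by exact_mod_cast h3
  have hM : 0 < ⌈(2 : ℝ) ^ ((n : ℝ) * R)⌉₊ := Nat.ceil_pos.2 (by positivity)
  have hfano := W.log_card_le_maxDirectedInfo f hf (c n) hM
  have hlog : (n : ℝ) * R ≤ Real.logb 2 ⌈(2 : ℝ) ^ ((n : ℝ) * R)⌉₊ := by
    rw [Real.le_logb_iff_rpow_le (by norm_num) (by exact_mod_cast hM)]
    exact Nat.le_ceil _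
  rw [one_div, ← div_eq_inv_mul, le_div_iff₀ hn]
  calc _ = (1 - W.errorProb (c n)) * (n * R) - 1 := by field_simp
    _ ≤ (1 - W.errorProb (c n)) * Real.logb 2 ⌈(2 : ℝ) ^ ((n : ℝ) * R)⌉₊ - 1 := by
        have := mul_le_mul_of_nonneg_left hlog (sub_nonneg.2 h2.le)
        linarith
    _ ≤ _ := hfano

theorem achievable_zero [Nonempty X] : W.Achievable 0 := by
  have hM : ∀ n : ℕ, ⌈(2 : ℝ) ^ ((n : ℝ) * 0)⌉₊ = 1 := fun n => by simp
  refine ⟨fun n => ⟨fun _ _ _ _ => Classical.arbitrary X, fun _ => ⟨0, by simp⟩⟩, ?_⟩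
  refine tendsto_const_nhds.congr fun n => ?_
  refine (Finset.sum_eq_zero fun m _ => Finset.sum_eq_zero fun s _ =>
    Finset.sum_eq_zero fun y _ => if_pos ?_).symm
  have : Subsingleton (Fin ⌈(2 : ℝ) ^ ((n : ℝ) * 0)⌉₊) := by rw [hM]; infer_instance
  exact Subsingleton.elim _ _

end FSC

/-- The capacity is a genuine supremum, the maxima are attained, and the limit exists and is equal
to the capacity; the elements of `U` are in bijection, via `f`, with all strategies `S → X`. -/
theorem theorem1 {X Y S U : Type*} [Fintype X] [Fintype Y] [Fintype S] [Fintype U]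
    (W : FSC X Y S) (hW : W.StronglyConnected)
    (f : U → S → X) (hf : Function.Bijective f) :
    Nat.card U = Nat.card X ^ Nat.card S ∧
    IsLUB {R : ℝ | W.Achievable R} W.capacity ∧
    (∀ N : ℕ, IsGreatest (Set.range fun q : CausalDist U Y N => W.auxDirectedInfo f q)
      (W.maxDirectedInfo f N)) ∧
    Tendsto (fun N : ℕ => (1 / (N : ℝ)) * W.maxDirectedInfo f N) atTop (𝓝 W.capacity) := by
  obtain ⟨s⟩ := W.nonempty_state
  -- Strong connectivity provides an input distribution, so there is an input letter.
  have hX : Nonempty X := by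
    obtain ⟨T, p, hp, -⟩ := hW s s
    by_contra h
    rw [not_nonempty_iff] at h
    have := (hp 0 s).2
    simp at this
  have hU : Nonempty U := ⟨(hf.2 fun _ => Classical.arbitrary X).choose⟩
  have hbdd : ∀ R, W.Achievable R → R ≤ Real.logb 2 (Fintype.card Y) := by
    intro R hR
    refine le_of_forall_lt fun r hr => ?_
    obtain ⟨N, h1, h2⟩ := ((W.eventually_lt_of_achievable f hf.2 hR hr).and
      (eventually_gt_atTop 0)).exists
    obtain ⟨q, hq⟩ := (W.isGreatest_maxDirectedInfo f N).1
    have hN : (0 : ℝ) < N := by exact_mod_cast h2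
    refine h1.trans_le ?_
    rw [one_div, ← div_eq_inv_mul, div_le_iff₀ hN, ← hq, mul_comm]
    exact W.auxDirectedInfo_le f q
  have hlub : IsLUB {R : ℝ | W.Achievable R} W.capacity :=
    isLUB_csSup ⟨0, W.achievable_zero⟩ ⟨_, fun R hR => hbdd R hR⟩
  refine ⟨?_, hlub, W.isGreatest_maxDirectedInfo f, ?_⟩
  · rw [Nat.card_congr (Equiv.ofBijective f hf), Nat.card_fun]
  refine tendsto_order.2 ⟨fun r hr => ?_, fun r hr => ?_⟩
  · obtain ⟨R, hR, h1⟩ := (lt_isLUB_iff hlub).1 hr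
    exact W.eventually_lt_of_achievable f hf.2 hR h1
  · by_contra h
    rw [not_eventually] at h
    have h0 : 0 ≤ W.capacity := hlub.1 W.achievable_zero
    obtain ⟨R, hR1, hR2⟩ := exists_between hr
    have := W.achievable_of_frequently f hW hf.2 (h0.trans hR1.le) (sub_pos.2 hR2)
      (h.mono fun N hN => by linarith [not_lt.1 hN])
    exact absurd (hlub.1 this) (not_le.2 hR1)
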